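/- **Theorem 1.** Let $\mathbb{T}=\mathbb{R}/\mathbb{Z}$ and, for $s\in\mathbb{R}$, let $$\|f\|_{H^s(\mathbb{T})}=\Big(\sum_{n\in\mathbb{Z}}(1+n^2)^s\,|\widehat f(n)|^2\Big)^{1/2},\qquad \widehat f(n)=\int_{\mathbb{T}}f(x)e^{-2\pi i n x}\,dx .$$ Let $s\le-\tfrac12$. Consider, for either choice of the sign, the cubic nonlinear Schrödinger equation on the circle $$ i\partial_t u-\partial_x^2u\pm|u|^2u=0,\qquad (x,t)\in\mathbb{T}\times\mathbb{R}. \tag{NLS}$$ Then for every $\varepsilon>0$ there exist a global-in-time classical solution $u=u(\varepsilon)$ of (NLS) (that is, $u$, $\partial_tu$, $\partial_x^2u$ exist and are continuous on $\mathbb{T}\times\mathbb{R}$ and the equation holds pointwise) and a time $t\in(0,\varepsilon)$ such that $$\|u(0)\|_{H^s(\mathbb{T})}<\varepsilon\qquad\text{and}\qquad\|u(t)\|_{H^s(\mathbb{T})}>\varepsilon^{-1}.$$ The same assertion holds, again for either sign, for the Wick ordered cubic NLS $$ i\partial_t u-\partial_x^2u\pm\Big(|u|^2-2\int_{\mathbb{T}}|u|^2\,dx\Big)u=0,\qquad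 (x,t)\in\mathbb{T}\times\mathbb{R}.$$ -/

import Mathlib

open scoped ENNReal

noncomputable section

/-- The Sobolev norm `‖f‖_{H^s(𝕋)} = (∑_{n ∈ ℤ} (1 + n²)^s |f̂(n)|²)^{1/2}` on the circle
`𝕋 = ℝ / ℤ`, where `f̂(n) = ∫_𝕋 f(x) e^{-2πinx} dx`.  It takes values in `[0, ∞]`, and is `∞`
when the series diverges. -/
def sobolevNorm (s : ℝ) (f : UnitAddCircle → ℂ) : ℝ≥0∞ :=
  (∑' n : ℤ, ENNReal.ofReal ((1 + (n : ℝ) ^ 2) ^ s * ‖fourierCoeff f n‖ ^ 2)) ^ (1 / 2 : ℝ)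

/-- The cubic nonlinearity `|f|² f`. -/
def cubic (f : UnitAddCircle → ℂ) (x : UnitAddCircle) : ℂ :=
  ((‖f x‖ ^ 2 : ℝ) : ℂ) * f x

/-- The Wick ordered cubic nonlinearity `(|f|² - 2 ⨍ |f|² dx) f`. -/
def wickCubic (f : UnitAddCircle → ℂ) (x : UnitAddCircle) : ℂ :=
  ((‖f x‖ ^ 2 - 2 * ⨍ y, ‖f y‖ ^ 2 ∂AddCircle.haarAddCircle : ℝ) : ℂ) * f x

/-- `u = u(t, x)` is a global-in-time classical solution, on `ℝ × 𝕋`, of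
`i ∂ₜu - ∂ₓ²u + σ N(u) = 0`, where `N` acts on functions of the space variable: `u`, `∂ₜu` and
`∂ₓ²u` exist and are jointly continuous, and the equation holds at every point.
Space derivatives are taken along the covering map `ℝ → 𝕋`. -/
structure IsClassicalNLSSolution (N : (UnitAddCircle → ℂ) → UnitAddCircle → ℂ) (σ : ℝ)
    (u : ℝ → UnitAddCircle → ℂ) : Prop where
  continuous : Continuous fun p : ℝ × UnitAddCircle => u p.1 p.2
  differentiable_time : ∀ x : UnitAddCircle, Differentiable ℝ fun t : ℝ => u t x
  continuous_deriv_time :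
    Continuous fun p : ℝ × UnitAddCircle => deriv (fun t : ℝ => u t p.2) p.1
  contDiff_space : ∀ t : ℝ, ContDiff ℝ 2 fun y : ℝ => u t (y : UnitAddCircle)
  continuous_deriv_space :
    Continuous fun p : ℝ × ℝ => iteratedDeriv 2 (fun y : ℝ => u p.1 (y : UnitAddCircle)) p.2
  equation : ∀ t x : ℝ,
    Complex.I * deriv (fun τ : ℝ => u τ (x : UnitAddCircle)) t
      - iteratedDeriv 2 (fun y : ℝ => u t (y : UnitAddCircle)) x
      + (σ : ℂ) * N (u t) (x : UnitAddCircle) = 0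

end

/-!
The mechanism is a transfer of energy from high to low frequencies. Let the solution start from
`R ∑ e^{2πinx}`, the sum running over the box of frequencies `N ≤ n ≤ 4N`. Every frequency `n` in
`[0, N)` is of the form `i - j + k` with `i, j, k` in the box, in at least `N²` ways, and for
`t ≪ N⁻²` all these interactions have nearly the same phase, so that the cubic term feeds the
frequency `n` at a rate `∼ R³N²` (`le_re_cubicForm_highBox`). If moreover `t ≪ (RN)⁻²`, then the
remainder is negligible: as the cubic term is Lipschitz in the supremum norm of the Fourier
coefficients with a constant `∼ (RN)²`, governed by their `ℓ¹` norm `∼ RN`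
(`norm_cubicForm_apply_sub_le`), all coefficients stay close to their initial values. Hence
`|û(t, n)| ≳ R³N²t` for `0 ≤ n < N` (`le_norm_apply_of_solution`).

Now let `R = δ N^{-s-1/2}`, so that the initial `Hˢ` norm is `≲ δ`, and `t = c N^{2s-1}`. For
`s ≤ -1/2` both restrictions on `t` hold and `|û(t, n)| ≳ δ²R`, whence
`‖u(t)‖² ≳ δ⁶ N^{-2s-1} ∑_{0 ≤ n < N} (1 + n²)ˢ ≥ δ⁶ ∑_{n < N} 1 / (n + 1)`, which diverges as
`N → ∞` with `δ` fixed (`exists_solution_norm_inflation`); at `s = -1/2` it does so only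
logarithmically.

The bounds above are proved for the actual solution, which has to be smooth and global. It is
constructed as a curve in `ℓ¹` of Fourier coefficients, multiplied by `(1 + n²)³` and seen from the
linear flow; there the equation is an ordinary differential equation with a locally Lipschitz
field. Conservation of mass and energy, with a Gagliardo-Nirenberg inequality that absorbs the
quartic energy in the focusing case, bounds the unweighted `ℓ¹` norm. The field grows at most
linearly in the weighted norm once the unweighted one is bounded, so by Grönwall's inequality
solutions are global (`exists_global_solution`), and the weight makes them classical
(`isClassicalNLSSolution_solutionAt`).

Since the mass is conserved, multiplication by a phase depending on time only takes solutions of the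
cubic equation to solutions of the Wick ordered one (`IsClassicalNLSSolution.wick`), and it does not
change Sobolev norms.
-/

/-! ### Global solutions of ordinary differential equations with an a priori bound -/

section ODE

open Set Metric
open scoped NNReal

variable {E : Type*} [NormedAddCommGroup E] [NormedSpace ℝ E]

/-- Cutting a field off outside a ball makes a locally Lipschitz field globally Lipschitz. -/
theorem lipschitzWith_cutoff_smul {g : E → E} {R : ℝ} {K : ℝ≥0} (hR : 0 ≤ R)
    (hlip : LipschitzOnWith K g (closedBall 0 (R + 1))) (hzero : g 0 = 0) :
    LipschitzWith (K * (R + 1).toNNReal + K)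
      (fun x => max 0 (min 1 (R + 1 - ‖x‖)) • g x) := by
  set χ : E → ℝ := fun x => max 0 (min 1 (R + 1 - ‖x‖)) with hχ
  have hχ0 : ∀ x, 0 ≤ χ x := fun x => le_max_left _ _
  have hχ1 : ∀ x, χ x ≤ 1 := fun x => max_le zero_le_one (min_le_left _ _)
  have hχout : ∀ x, R + 1 < ‖x‖ → χ x = 0 := fun x hx =>
    max_eq_left ((min_le_right _ _).trans (by linarith))
  have hχl : ∀ x y, |χ x - χ y| ≤ ‖x - y‖ := by
    intro x y
    have h1 := abs_max_sub_max_le_abs (min 1 (R + 1 - ‖x‖)) (min 1 (R + 1 - ‖y‖)) 0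
    have h2 := abs_min_sub_min_le_max 1 (R + 1 - ‖x‖) 1 (R + 1 - ‖y‖)
    have h3 := abs_norm_sub_norm_le y x
    simp only [hχ, max_comm (0 : ℝ)]
    refine h1.trans (h2.trans ?_)
    rw [sub_self, abs_zero, norm_sub_rev x y]
    refine max_le (norm_nonneg _) ?_
    rwa [show R + 1 - ‖x‖ - (R + 1 - ‖y‖) = ‖y‖ - ‖x‖ by ring]
  have hg : ∀ x, ‖x‖ ≤ R + 1 → ‖g x‖ ≤ K * (R + 1) := by
    intro x hx
    have := hlip.norm_sub_le (x := x) (y := 0) (by simpa using hx) (by simp; linarith)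
    rw [hzero, sub_zero, sub_zero] at this
    exact this.trans (by gcongr)
  refine LipschitzWith.of_dist_le_mul fun x y => ?_
  rw [dist_eq_norm, dist_eq_norm]
  change ‖χ x • g x - χ y • g y‖ ≤ _
  push_cast
  rw [Real.coe_toNNReal _ (by linarith), add_mul]
  have hK : (0 : ℝ) ≤ K := K.2
  by_cases hy : ‖y‖ ≤ R + 1
  · have e : χ x • g x - χ y • g y = (χ x - χ y) • g y + χ x • (g x - g y) := by
      module
    rw [e]
    refine (norm_add_le _ _).trans (add_le_add ?_ ?_)
    · rw [norm_smul, mul_comm, Real.norm_eq_abs]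
      exact mul_le_mul (hg y hy) (hχl x y) (abs_nonneg _) (by positivity)
    · rw [norm_smul, Real.norm_eq_abs, abs_of_nonneg (hχ0 x)]
      by_cases hx : ‖x‖ ≤ R + 1
      · have := hlip.norm_sub_le (x := x) (y := y) (by simpa using hx) (by simpa using hy)
        exact (mul_le_of_le_one_left (norm_nonneg _) (hχ1 x)).trans this
      · rw [hχout x (not_le.1 hx), zero_mul]
        positivity
  · have hy0 := hχout y (not_le.1 hy)
    by_cases hx : ‖x‖ ≤ R + 1
    · have e : χ x • g x - χ y • g y = (χ x - χ y) • g x := by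
        rw [hy0]; module
      rw [e, norm_smul, mul_comm, Real.norm_eq_abs]
      have := mul_le_mul (hg x hx) (hχl x y) (abs_nonneg _) (by positivity)
      have h2 : 0 ≤ (K : ℝ) * ‖x - y‖ := by positivity
      linarith
    · rw [hy0, hχout x (not_le.1 hx)]
      simp only [zero_smul, sub_zero, norm_zero]
      positivity

variable [CompleteSpace E]

/-- A priori bounded, locally Lipschitz equations are solvable on every bounded time interval:
the cut-off equation is solvable by the Picard-Lindelöf theorem, and the a priori bound keeps its
solution out of the region where the cut-off acts. -/
theorem exists_solution_Ioo_of_apriori_bound {f : ℝ → E → E} {x₀ : E}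
    (hcont : ∀ x, Continuous fun t => f t x) (K : ℝ → ℝ≥0)
    (hlip : ∀ R t, LipschitzOnWith (K R) (f t) (closedBall 0 R)) (hzero : ∀ t, f t 0 = 0)
    {B : ℝ → ℝ} (hB : Monotone B)
    (hapriori : ∀ T, 0 < T → ∀ v : ℝ → E, v 0 = x₀ →
      (∀ t ∈ Ioo (-T) T, HasDerivAt v (f t (v t)) t) → ∀ t ∈ Ioo (-T) T, ‖v t‖ ≤ B T)
    {T : ℝ} (hT : 0 < T) :
    ∃ v : ℝ → E, v 0 = x₀ ∧ ∀ t ∈ Ioo (-T) T, HasDerivAt v (f t (v t)) t := by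
  set R : ℝ := max (B T) ‖x₀‖ + 1 with hR
  have hR0 : 0 ≤ R := by
    have := (norm_nonneg x₀).trans (le_max_right (B T) _); linarith
  set χ : E → ℝ := fun x => max 0 (min 1 (R + 1 - ‖x‖)) with hχ
  set K' : ℝ≥0 := K (R + 1) * (R + 1).toNNReal + K (R + 1) with hK'
  have hL := fun t => lipschitzWith_cutoff_smul hR0 (hlip (R + 1) t) (hzero t)
  set L : ℝ≥0 := K (R + 1) * (R + 1).toNNReal with hLdef
  have hbd : ∀ t x, ‖χ x • f t x‖ ≤ L := by
    intro t x
    by_cases hx : ‖x‖ ≤ R + 1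
    · have h1 := (hlip (R + 1) t).norm_sub_le (x := x) (y := 0) (by simpa using hx)
        (by simp; linarith)
      rw [hzero, sub_zero, sub_zero] at h1
      rw [norm_smul, Real.norm_eq_abs, abs_of_nonneg (le_max_left _ _)]
      have h2 : χ x ≤ 1 := max_le zero_le_one (min_le_left _ _)
      rw [hLdef]
      push_cast
      rw [Real.coe_toNNReal _ (by linarith)]
      refine (mul_le_of_le_one_left (norm_nonneg _) h2).trans (h1.trans ?_)
      gcongr
    · have : χ x = 0 := max_eq_left ((min_le_right _ _).trans (by linarith [not_le.1 hx]))
      rw [this, zero_smul, norm_zero]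
      exact L.2
  have h0 : (0 : ℝ) ∈ Icc (-T) T := ⟨by linarith, hT.le⟩
  have hPL : IsPicardLindelof (fun t x => χ x • f t x) (⟨0, h0⟩ : Icc (-T) T) x₀
      (L * T.toNNReal) 0 L K' :=
    { lipschitzOnWith := fun t _ => (hL t).lipschitzOnWith
      continuousOn := fun x _ => ((hcont x).const_smul (χ x)).continuousOn
      norm_le := fun t _ x _ => hbd t x
      mul_max_le := by
        simp [Real.coe_toNNReal _ hT.le] }
  obtain ⟨v, hv0, hv⟩ := hPL.exists_eq_forall_mem_Icc_hasDerivWithinAt₀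
  simp only at hv0
  have hvc : ContinuousOn v (Icc (-T) T) := fun t ht => (hv t ht).continuousWithinAt
  have hv' : ∀ t ∈ Ioo (-T) T, HasDerivAt v (χ (v t) • f t (v t)) t := fun t ht =>
    (hv t (Ioo_subset_Icc_self ht)).hasDerivAt (Icc_mem_nhds ht.1 ht.2)
  have hχ1 : ∀ x : E, ‖x‖ < R → χ x = 1 := by
    intro x hx
    have : min 1 (R + 1 - ‖x‖) = 1 := min_eq_left (by linarith)
    simp only [hχ, this]
    norm_num
  have key : ∀ t ∈ Icc (-T) T, ‖v t‖ < R := by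
    -- Otherwise, up to the exit time `τ` nearest to `0`, `v` solves the original equation.
    by_contra! hcon
    obtain ⟨t₁, ht₁, ht₁R⟩ := hcon
    have hclosed : IsClosed (Icc (-T) T ∩ v ⁻¹' {x | R ≤ ‖x‖}) :=
      hvc.preimage_isClosed_of_isClosed isClosed_Icc
        (isClosed_le continuous_const continuous_norm)
    have hcomp : IsCompact (Icc (-T) T ∩ v ⁻¹' {x | R ≤ ‖x‖}) :=
      isCompact_Icc.of_isClosed_subset hclosed inter_subset_left
    obtain ⟨τ, ⟨hτ, hτR⟩, hmin⟩ := hcomp.exists_isMinOn ⟨t₁, ht₁, ht₁R⟩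
      (continuous_abs.continuousOn)
    have hτR : R ≤ ‖v τ‖ := hτR
    have hτ0 : 0 < |τ| := by
      rw [abs_pos]
      rintro rfl
      rw [hv0] at hτR
      have := le_max_right (B T) ‖x₀‖
      linarith
    have hτT : |τ| ≤ T := abs_le.2 hτ
    have hsub : Ioo (-|τ|) |τ| ⊆ Ioo (-T) T := Ioo_subset_Ioo (by linarith) hτT
    have hsmall : ∀ t ∈ Ioo (-|τ|) |τ|, ‖v t‖ < R := by
      intro t ht
      by_contra! hge
      have := hmin (a := t) ⟨Ioo_subset_Icc_self (hsub ht), hge⟩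
      have h2 : |t| < |τ| := abs_lt.2 ht
      exact absurd this (not_le.2 h2)
    have hsol : ∀ t ∈ Ioo (-|τ|) |τ|, HasDerivAt v (f t (v t)) t := by
      intro t ht
      have := hv' t (hsub ht)
      rwa [hχ1 _ (hsmall t ht), one_smul] at this
    have hb := hapriori |τ| hτ0 v hv0 hsol
    have hclos : τ ∈ closure (Ioo (-|τ|) |τ|) := by
      rw [closure_Ioo (by linarith : -|τ| ≠ |τ|)]
      exact abs_le.1 le_rfl
    have hcw : ContinuousWithinAt v (Ioo (-|τ|) |τ|) τ :=
      (hvc τ hτ).mono (hsub.trans Ioo_subset_Icc_self)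
    have : v τ ∈ closedBall (0 : E) (B T) := by
      have hmaps : MapsTo v (Ioo (-|τ|) |τ|) (closedBall (0 : E) (B T)) := fun t ht => by
        simpa using (hb t ht).trans (hB hτT)
      have := hcw.mem_closure hclos hmaps
      rwa [isClosed_closedBall.closure_eq] at this
    have h3 : ‖v τ‖ ≤ B T := by simpa using this
    have := le_max_left (B T) ‖x₀‖
    linarith
  refine ⟨v, hv0, fun t ht => ?_⟩
  have := hv' t ht
  rwa [hχ1 _ (key t (Ioo_subset_Icc_self ht)), one_smul] at this

/-- A priori bounded, locally Lipschitz equations have global solutions. -/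
theorem exists_global_solution_of_apriori_bound {f : ℝ → E → E} {x₀ : E}
    (hcont : ∀ x, Continuous fun t => f t x) (K : ℝ → ℝ≥0)
    (hlip : ∀ R t, LipschitzOnWith (K R) (f t) (closedBall 0 R)) (hzero : ∀ t, f t 0 = 0)
    {B : ℝ → ℝ} (hB : Monotone B)
    (hapriori : ∀ T, 0 < T → ∀ v : ℝ → E, v 0 = x₀ →
      (∀ t ∈ Ioo (-T) T, HasDerivAt v (f t (v t)) t) → ∀ t ∈ Ioo (-T) T, ‖v t‖ ≤ B T) :
    ∃ v : ℝ → E, v 0 = x₀ ∧ ∀ t, HasDerivAt v (f t (v t)) t := by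
  have hpos : ∀ m : ℕ, (0 : ℝ) < m + 1 := fun m => by positivity
  choose v hv0 hv using fun m : ℕ =>
    exists_solution_Ioo_of_apriori_bound hcont K hlip hzero hB hapriori (hpos m)
  have hagree : ∀ m k : ℕ, m ≤ k →
      EqOn (v m) (v k) (Ioo (-((m : ℝ) + 1)) ((m : ℝ) + 1)) := by
    intro m k hmk
    have hmk' : (m : ℝ) + 1 ≤ k + 1 := by exact_mod_cast Nat.succ_le_succ hmk
    have hsub : Ioo (-((m : ℝ) + 1)) ((m : ℝ) + 1) ⊆ Ioo (-((k : ℝ) + 1)) ((k : ℝ) + 1) :=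
      Ioo_subset_Ioo (by linarith) hmk'
    refine ODE_solution_unique_of_mem_Ioo (s := fun _ => closedBall 0 (B (k + 1)))
      (t₀ := 0) (fun t _ => hlip (B (k + 1)) t) ⟨by linarith [hpos m], hpos m⟩
      (fun t ht => ⟨hv m t ht, ?_⟩)
      (fun t ht => ⟨hv k t (hsub ht), ?_⟩) (by rw [hv0, hv0])
    · simpa using (hapriori _ (hpos m) _ (hv0 m) (hv m) t ht).trans (hB hmk')
    · simpa using hapriori _ (hpos k) _ (hv0 k) (hv k) t (hsub ht)
  refine ⟨fun t => v ⌈|t|⌉₊ t, by simp [hv0], fun t => ?_⟩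
  set M : ℕ := ⌈|t|⌉₊ + 1 with hM
  have ht : |t| < M := by
    have := Nat.le_ceil |t|
    rw [hM]; push_cast; linarith
  have heq : ∀ᶠ s : ℝ in nhds t, v ⌈|s|⌉₊ s = v M s := by
    have : ∀ᶠ s : ℝ in nhds t, |s| < M := continuous_abs.continuousAt.eventually_lt_const ht
    filter_upwards [this] with s hs
    have h1 : ⌈|s|⌉₊ ≤ M := Nat.ceil_le.2 hs.le
    refine hagree _ _ h1 (abs_lt.1 ?_)
    have := Nat.le_ceil |s|
    linarith
  have hd : HasDerivAt (v M) (f t (v M t)) t :=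
    hv M t (abs_lt.1 (by linarith))
  have := hd.congr_of_eventuallyEq heq
  rwa [← heq.self_of_nhds] at this

end ODE

/-! ### Absolutely summable Fourier coefficients -/

noncomputable section WienerAlgebra

open scoped ComplexConjugate BoundedContinuousFunction

/-- The function `z e^{2πinx}` on the circle. -/
def planeWave (n : ℤ) (z : ℂ) : C(UnitAddCircle, ℂ) :=
  ⟨fun x => z * fourier n x, by fun_prop⟩

theorem planeWave_apply (n : ℤ) (z : ℂ) (x : UnitAddCircle) :
    planeWave n z x = z * fourier n x := rfl

theorem planeWave_zero_right (n : ℤ) : planeWave n 0 = 0 := by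
  ext x; rw [planeWave_apply, zero_mul]; rfl

theorem planeWave_add (n : ℤ) (z w : ℂ) : planeWave n (z + w) = planeWave n z + planeWave n w := by
  ext x; simp only [planeWave_apply, ContinuousMap.add_apply, add_mul]

theorem planeWave_real_smul (n : ℤ) (r : ℝ) (z : ℂ) :
    planeWave n (r * z) = r • planeWave n z := by
  ext x
  rw [ContinuousMap.smul_apply, planeWave_apply, planeWave_apply, Complex.real_smul, mul_assoc]

theorem planeWave_mul (m n : ℤ) (z w : ℂ) :
    planeWave m z * planeWave n w = planeWave (m + n) (z * w) := by
  ext x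
  rw [ContinuousMap.mul_apply, planeWave_apply, planeWave_apply, planeWave_apply, fourier_add]
  ring

theorem star_planeWave (n : ℤ) (z : ℂ) : star (planeWave n z) = planeWave (-n) (conj z) := by
  ext x
  rw [ContinuousMap.star_apply, planeWave_apply, planeWave_apply, fourier_neg, Complex.star_def,
    map_mul]

theorem norm_planeWave (n : ℤ) (z : ℂ) : ‖planeWave n z‖ = ‖z‖ := by
  have hf : ∀ x : UnitAddCircle, ‖fourier n x‖ = 1 := fun x => by
    rw [fourier_apply]; exact Circle.norm_coe _
  refine le_antisymm ((ContinuousMap.norm_le _ (norm_nonneg _)).2 fun x => ?_) ?_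
  · rw [planeWave_apply, norm_mul, hf, mul_one]
  · have := (planeWave n z).norm_coe_le_norm 0
    rwa [planeWave_apply, norm_mul, hf, mul_one] at this

/-- Absolutely summable sequences of Fourier coefficients. -/
abbrev SummableCoeffs : Type := lp (fun _ : ℤ => ℂ) 1

/-- Bounded sequences, acting on coefficients as Fourier multipliers. -/
abbrev Multiplier : Type := ℤ →ᵇ ℂ

theorem SummableCoeffs.summable_norm (a : SummableCoeffs) : Summable fun n => ‖a n‖ := by
  simpa using (lp.memℓp a).summable (by simp)

theorem SummableCoeffs.norm_eq_tsum (a : SummableCoeffs) : ‖a‖ = ∑' n, ‖a n‖ := by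
  simpa using lp.norm_eq_tsum_rpow (p := 1) (by simp) a

theorem SummableCoeffs.norm_apply_le (a : SummableCoeffs) (n : ℤ) : ‖a n‖ ≤ ‖a‖ :=
  lp.norm_apply_le_norm one_ne_zero a n

/-- A bounded function on `ℤ` as a Fourier multiplier. -/
def Multiplier.ofBounded (f : ℤ → ℂ) (C : ℝ) (hf : ∀ n, ‖f n‖ ≤ C) : Multiplier :=
  BoundedContinuousFunction.ofNormedAddCommGroupDiscrete f C hf

@[simp] theorem Multiplier.ofBounded_apply (f : ℤ → ℂ) (C : ℝ) (hf : ∀ n, ‖f n‖ ≤ C) (n : ℤ) :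
    Multiplier.ofBounded f C hf n = f n := rfl

theorem SummableCoeffs.summable_norm_planeWave (μ : Multiplier) (a : SummableCoeffs) :
    Summable fun n => ‖planeWave n (μ n * a n)‖ := by
  refine Summable.of_nonneg_of_le (fun _ => norm_nonneg _) (fun n => ?_)
    (a.summable_norm.mul_left ‖μ‖)
  rw [norm_planeWave, norm_mul]
  gcongr
  exact μ.norm_coe_le_norm n

/-- The Fourier series `∑ μₙ aₙ e^{2πinx}`, bilinear in the multiplier `μ` and in the
coefficients `a`, as a continuous function. It is linear over `ℝ` only for the sake of
differentiation in time. -/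
def fourierSynthesis : Multiplier →L[ℝ] SummableCoeffs →L[ℝ] C(UnitAddCircle, ℂ) :=
  LinearMap.mkContinuous₂
    (LinearMap.mk₂ ℝ
      (fun (μ : Multiplier) (a : SummableCoeffs) => ∑' n, planeWave n (μ n * a n))
      (fun μ ν a => by
        rw [← (SummableCoeffs.summable_norm_planeWave μ a).of_norm.tsum_add
          (SummableCoeffs.summable_norm_planeWave ν a).of_norm]
        simp only [BoundedContinuousFunction.coe_add, Pi.add_apply, add_mul, planeWave_add])
      (fun r μ a => by
        rw [← (SummableCoeffs.summable_norm_planeWave μ a).of_norm.tsum_const_smul]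
        refine tsum_congr fun n => ?_
        rw [← planeWave_real_smul]
        simp [mul_assoc])
      (fun μ a b => by
        rw [← (SummableCoeffs.summable_norm_planeWave μ a).of_norm.tsum_add
          (SummableCoeffs.summable_norm_planeWave μ b).of_norm]
        simp only [lp.coeFn_add, Pi.add_apply, mul_add, planeWave_add])
      (fun r μ a => by
        rw [← (SummableCoeffs.summable_norm_planeWave μ a).of_norm.tsum_const_smul]
        refine tsum_congr fun n => ?_
        rw [← planeWave_real_smul]
        simp [mul_left_comm]))
    1 (fun μ a => by
      rw [one_mul, SummableCoeffs.norm_eq_tsum, ← tsum_mul_left]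
      refine (norm_tsum_le_tsum_norm (SummableCoeffs.summable_norm_planeWave μ a)).trans ?_
      refine (SummableCoeffs.summable_norm_planeWave μ a).tsum_le_tsum (fun n => ?_)
        (a.summable_norm.mul_left ‖μ‖)
      rw [norm_planeWave, norm_mul]
      gcongr
      exact μ.norm_coe_le_norm n)

theorem hasSum_fourierSynthesis (μ : Multiplier) (a : SummableCoeffs) :
    HasSum (fun n => planeWave n (μ n * a n)) (fourierSynthesis μ a) :=
  (SummableCoeffs.summable_norm_planeWave μ a).of_norm.hasSum

theorem norm_fourierSynthesis_le (μ : Multiplier) (a : SummableCoeffs) :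
    ‖fourierSynthesis μ a‖ ≤ ∑' n, ‖μ n * a n‖ := by
  rw [← (hasSum_fourierSynthesis μ a).tsum_eq]
  refine (norm_tsum_le_tsum_norm (SummableCoeffs.summable_norm_planeWave μ a)).trans_eq ?_
  simp only [norm_planeWave]

theorem fourierSynthesis_single (μ : Multiplier) (n : ℤ) (z : ℂ) :
    fourierSynthesis μ (lp.single 1 n z) = planeWave n (μ n * z) := by
  rw [← (hasSum_fourierSynthesis μ _).tsum_eq, tsum_eq_single n]
  · rw [lp.single_apply_self]
  · intro m hm
    rw [lp.single_apply_ne _ _ _ hm, mul_zero, planeWave_zero_right]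

theorem hasSum_fourierSynthesis_apply (μ : Multiplier) (a : SummableCoeffs) (x : UnitAddCircle) :
    HasSum (fun n => μ n * a n * fourier n x) (fourierSynthesis μ a x) :=
  (hasSum_fourierSynthesis μ a).map (ContinuousMap.evalCLM ℝ x)
    (ContinuousMap.evalCLM ℝ x).continuous

/-- The mean over the circle as a continuous linear functional. -/
def circleMean : C(UnitAddCircle, ℂ) →L[ℝ] ℂ :=
  LinearMap.mkContinuous
    { toFun := fun f => ∫ x, f x ∂AddCircle.haarAddCircle
      map_add' := fun f g => MeasureTheory.integral_add
        (f.continuous.integrable_of_hasCompactSupport (HasCompactSupport.of_compactSpace _))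
        (g.continuous.integrable_of_hasCompactSupport (HasCompactSupport.of_compactSpace _))
      map_smul' := fun r f => MeasureTheory.integral_smul r _ }
    1 (fun f => by
      rw [one_mul]
      have := MeasureTheory.norm_integral_le_of_norm_le_const
        (μ := (AddCircle.haarAddCircle : MeasureTheory.Measure UnitAddCircle))
        (Filter.Eventually.of_forall (fun x => f.norm_coe_le_norm x))
      simpa using this)

theorem circleMean_apply (f : C(UnitAddCircle, ℂ)) :
    circleMean f = ∫ x, f x ∂AddCircle.haarAddCircle := rfl

theorem circleMean_star (f : C(UnitAddCircle, ℂ)) :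
    circleMean (star f) = conj (circleMean f) :=
  integral_conj

theorem fourierCoeff_eq_circleMean (f : C(UnitAddCircle, ℂ)) (n : ℤ) :
    fourierCoeff f n = circleMean (planeWave (-n) 1 * f) := by
  rw [circleMean_apply]
  simp only [fourierCoeff, ContinuousMap.mul_apply, planeWave_apply, one_mul, smul_eq_mul]

theorem circleMean_planeWave (n : ℤ) (z : ℂ) :
    circleMean (planeWave n z) = if n = 0 then z else 0 := by
  have h2 : fourierCoeff (fourier n : C(UnitAddCircle, ℂ)) 0 = circleMean (planeWave n 1) := by
    rw [circleMean_apply]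
    simp only [fourierCoeff, neg_zero, planeWave_apply, one_mul, smul_eq_mul, fourier_zero]
  have h1 : circleMean (planeWave n z) = z * circleMean (planeWave n 1) := by
    rw [circleMean_apply, circleMean_apply, ← MeasureTheory.integral_const_mul]
    simp only [planeWave_apply, one_mul]
  rw [h1, ← h2, fourierCoeff_fourier]
  by_cases hn : n = 0
  · simp [hn]
  · simp [hn, eq_comm]

/-- A mean against a Fourier series can be computed term by term. -/
theorem hasSum_circleMean_mul_fourierSynthesis (f : C(UnitAddCircle, ℂ)) (μ : Multiplier)
    (a : SummableCoeffs) :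
    HasSum (fun n => circleMean (f * planeWave n (μ n * a n)))
      (circleMean (f * fourierSynthesis μ a)) :=
  ((hasSum_fourierSynthesis μ a).mul_left f).map circleMean circleMean.continuous

theorem fourierCoeff_fourierSynthesis (μ : Multiplier) (a : SummableCoeffs) (n : ℤ) :
    fourierCoeff (fourierSynthesis μ a) n = μ n * a n := by
  rw [fourierCoeff_eq_circleMean, ← (hasSum_circleMean_mul_fourierSynthesis _ _ _).tsum_eq,
    tsum_eq_single n]
  · rw [planeWave_mul, circleMean_planeWave, neg_add_cancel, if_pos rfl, one_mul]
  · intro m hm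
    rw [planeWave_mul, circleMean_planeWave, if_neg]
    exact fun h => hm (by linarith)

theorem circleMean_planeWave_zero_mul (z : ℂ) (f : C(UnitAddCircle, ℂ)) :
    circleMean (planeWave 0 z * f) = z * circleMean f := by
  rw [circleMean_apply, circleMean_apply, ← MeasureTheory.integral_const_mul]
  simp only [ContinuousMap.mul_apply, planeWave_apply, fourier_zero, mul_one]

/-- Parseval's identity. -/
theorem hasSum_circleMean_star_mul (μ ν : Multiplier) (a b : SummableCoeffs) :
    HasSum (fun n => conj (μ n * a n) * (ν n * b n))
      (circleMean (star (fourierSynthesis μ a) * fourierSynthesis ν b)) := by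
  convert hasSum_circleMean_mul_fourierSynthesis (star (fourierSynthesis μ a)) ν b using 2 with n
  have h1 : circleMean (star (fourierSynthesis μ a) * planeWave n (ν n * b n))
      = conj (circleMean (planeWave (-n) (conj (ν n * b n)) * fourierSynthesis μ a)) := by
    rw [← circleMean_star, star_mul, star_planeWave, neg_neg, Complex.conj_conj]
  have h2 : planeWave (-n) (conj (ν n * b n)) * fourierSynthesis μ a
      = planeWave 0 (conj (ν n * b n)) * (planeWave (-n) 1 * fourierSynthesis μ a) := by
    rw [← mul_assoc, planeWave_mul, zero_add, mul_one]
  rw [h1, h2, circleMean_planeWave_zero_mul, ← fourierCoeff_eq_circleMean, fourierCoeff_fourierSynthesis]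
  simp only [map_mul, Complex.conj_conj]
  ring

/-- Fourier series may be differentiated term by term if the differentiated series is
absolutely summable. -/
theorem hasDerivAt_fourierSynthesis (μ ν : Multiplier) (a : SummableCoeffs)
    (hν : ∀ n : ℤ, ν n = 2 * Real.pi * Complex.I * n * μ n) (x : ℝ) :
    HasDerivAt (fun y : ℝ => fourierSynthesis μ a (y : UnitAddCircle))
      (fourierSynthesis ν a (x : UnitAddCircle)) x := by
  have e : (fun y : ℝ => fourierSynthesis μ a (y : UnitAddCircle))
      = fun y : ℝ => ∑' n : ℤ, μ n * a n * fourier n (y : UnitAddCircle) :=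
    funext fun y => (hasSum_fourierSynthesis_apply μ a y).tsum_eq.symm
  rw [e, ← (hasSum_fourierSynthesis_apply ν a x).tsum_eq]
  have hd : ∀ (n : ℤ) (y : ℝ), HasDerivAt
      (fun y : ℝ => μ n * a n * fourier n (y : UnitAddCircle))
      (ν n * a n * fourier n (y : UnitAddCircle)) y := by
    intro n y
    refine ((hasDerivAt_fourier 1 n y).const_mul (μ n * a n)).congr_deriv ?_
    rw [hν, Complex.ofReal_one, div_one]
    ring
  refine hasDerivAt_tsum (g := fun (n : ℤ) (y : ℝ) => μ n * a n * fourier n (y : UnitAddCircle))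
    (g' := fun (n : ℤ) (y : ℝ) => ν n * a n * fourier n (y : UnitAddCircle))
    (u := fun n => ‖ν n * a n‖) ?_ hd (fun n y => ?_) (y₀ := x)
    (hasSum_fourierSynthesis_apply μ a x).summable x
  · simpa only [norm_planeWave] using SummableCoeffs.summable_norm_planeWave ν a
  · rw [norm_mul, fourier_apply, Circle.norm_coe, mul_one]

end WienerAlgebra

/-! ### Cubic convolution forms on summable coefficients -/

noncomputable section CubicForm

open scoped ComplexConjugate

theorem summable_mul_three {f g h : ℤ → ℝ} (hf : Summable f) (hg : Summable g) (hh : Summable h)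
    (hf0 : ∀ n, 0 ≤ f n) (hg0 : ∀ n, 0 ≤ g n) (hh0 : ∀ n, 0 ≤ h n) :
    Summable fun p : ℤ × ℤ × ℤ => f p.1 * (g p.2.1 * h p.2.2) :=
  hf.mul_of_nonneg (hg.mul_of_nonneg hh hg0 hh0) hf0 fun _ => mul_nonneg (hg0 _) (hh0 _)

theorem tsum_mul_three {f g h : ℤ → ℝ} (hf : Summable f) (hg : Summable g) (hh : Summable h)
    (hf0 : ∀ n, 0 ≤ f n) (hg0 : ∀ n, 0 ≤ g n) (hh0 : ∀ n, 0 ≤ h n) :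
    ∑' p : ℤ × ℤ × ℤ, f p.1 * (g p.2.1 * h p.2.2)
      = (∑' n, f n) * ((∑' n, g n) * ∑' n, h n) := by
  rw [hg.tsum_mul_tsum hh (hg.mul_of_nonneg hh hg0 hh0)]
  exact (hf.tsum_mul_tsum (hg.mul_of_nonneg hh hg0 hh0)
    (summable_mul_three hf hg hh hf0 hg0 hh0)).symm

/-- The sequence `n ↦ ∑ K(i, j, k) aᵢ āⱼ aₖ`, the sum running over `i - j + k = n`.  For `K = 1`
these are the Fourier coefficients of `|f|² f`, where `f` has coefficients `a`. The series is taken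
in `ℓ¹`, where it converges absolutely for bounded `K`. -/
def cubicForm (K : ℤ × ℤ × ℤ → ℂ) (a : SummableCoeffs) : SummableCoeffs :=
  ∑' p : ℤ × ℤ × ℤ, lp.single 1 (p.1 - p.2.1 + p.2.2)
    (K p * (a p.1 * (starRingEnd ℂ (a p.2.1) * a p.2.2)))

theorem norm_cubicForm_term (K : ℤ × ℤ × ℤ → ℂ) (a : SummableCoeffs) (p : ℤ × ℤ × ℤ) :
    ‖(lp.single 1 (p.1 - p.2.1 + p.2.2)
      (K p * (a p.1 * (starRingEnd ℂ (a p.2.1) * a p.2.2))) : SummableCoeffs)‖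
      = ‖K p‖ * (‖a p.1‖ * (‖a p.2.1‖ * ‖a p.2.2‖)) := by
  rw [lp.norm_single (by norm_num)]
  simp only [norm_mul, RCLike.norm_conj]

theorem summable_norm_cubicForm {K : ℤ × ℤ × ℤ → ℂ} {C : ℝ} (hK : ∀ p, ‖K p‖ ≤ C)
    (a : SummableCoeffs) :
    Summable fun p : ℤ × ℤ × ℤ => ‖(lp.single 1 (p.1 - p.2.1 + p.2.2)
      (K p * (a p.1 * (starRingEnd ℂ (a p.2.1) * a p.2.2))) : SummableCoeffs)‖ := by
  simp only [norm_cubicForm_term]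
  refine Summable.of_nonneg_of_le (fun p => by positivity) (fun p => ?_)
    ((summable_mul_three a.summable_norm a.summable_norm a.summable_norm (fun _ => norm_nonneg _)
      (fun _ => norm_nonneg _) (fun _ => norm_nonneg _)).mul_left C)
  gcongr
  exact hK p

theorem hasSum_cubicForm {K : ℤ × ℤ × ℤ → ℂ} {C : ℝ} (hK : ∀ p, ‖K p‖ ≤ C)
    (a : SummableCoeffs) :
    HasSum (fun p : ℤ × ℤ × ℤ => (lp.single 1 (p.1 - p.2.1 + p.2.2)
      (K p * (a p.1 * (starRingEnd ℂ (a p.2.1) * a p.2.2))) : SummableCoeffs)) (cubicForm K a) :=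
  (summable_norm_cubicForm hK a).of_norm.hasSum

theorem cubicForm_zero (K : ℤ × ℤ × ℤ → ℂ) : cubicForm K 0 = 0 := by
  simp [cubicForm]

theorem norm_cubicForm_le {K : ℤ × ℤ × ℤ → ℂ} {C : ℝ} (hK : ∀ p, ‖K p‖ ≤ C)
    (a : SummableCoeffs) : ‖cubicForm K a‖ ≤ C * ‖a‖ ^ 3 := by
  have h3 := summable_mul_three a.summable_norm a.summable_norm a.summable_norm
    (fun _ => norm_nonneg _) (fun _ => norm_nonneg _) (fun _ => norm_nonneg _)
  have e := tsum_mul_three a.summable_norm a.summable_norm a.summable_norm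
    (fun _ => norm_nonneg _) (fun _ => norm_nonneg _) (fun _ => norm_nonneg _)
  rw [← a.norm_eq_tsum] at e
  rw [pow_three, ← e, ← tsum_mul_left]
  refine (norm_tsum_le_tsum_norm (summable_norm_cubicForm hK a)).trans ?_
  refine (summable_norm_cubicForm hK a).tsum_le_tsum (fun p => ?_) (h3.mul_left C)
  rw [norm_cubicForm_term]
  gcongr
  exact hK p

/-- A kernel which decays in two of its three variables is estimated by putting the weaker norm
`∑ β(n) |aₙ|` on the corresponding two factors. -/
theorem norm_cubicForm_le_of_kernel_le {K : ℤ × ℤ × ℤ → ℂ} {C : ℝ} (hK : ∀ p, ‖K p‖ ≤ C)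
    {β : ℤ → ℝ} (hβ : ∀ n, 0 ≤ β n) (hβ1 : ∀ n, β n ≤ 1) {D : ℝ}
    (hKβ : ∀ p : ℤ × ℤ × ℤ, ‖K p‖ ≤ D *
      (β p.2.1 * β p.2.2 + β p.1 * β p.2.2 + β p.1 * β p.2.1))
    (a : SummableCoeffs) :
    ‖cubicForm K a‖ ≤ 3 * D * (∑' n, β n * ‖a n‖) ^ 2 * ‖a‖ := by
  have hs := a.summable_norm
  have hn : ∀ n, 0 ≤ ‖a n‖ := fun _ => norm_nonneg _
  have hb : ∀ n, 0 ≤ β n * ‖a n‖ := fun n => mul_nonneg (hβ n) (hn n)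
  have hsb : Summable fun n => β n * ‖a n‖ :=
    Summable.of_nonneg_of_le hb (fun n => mul_le_of_le_one_left (hn n) (hβ1 n)) hs
  have s1 := summable_mul_three hs hsb hsb hn hb hb
  have s2 := summable_mul_three hsb hs hsb hb hn hb
  have s3 := summable_mul_three hsb hsb hs hb hb hn
  have e1 := tsum_mul_three hs hsb hsb hn hb hb
  have e2 := tsum_mul_three hsb hs hsb hb hn hb
  have e3 := tsum_mul_three hsb hsb hs hb hb hn
  rw [← a.norm_eq_tsum] at e1 e2 e3
  have hS := (((s1.add s2).add s3).mul_left D)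
  have key : ‖cubicForm K a‖ ≤ ∑' p : ℤ × ℤ × ℤ, D *
      (‖a p.1‖ * (β p.2.1 * ‖a p.2.1‖ * (β p.2.2 * ‖a p.2.2‖))
        + β p.1 * ‖a p.1‖ * (‖a p.2.1‖ * (β p.2.2 * ‖a p.2.2‖))
        + β p.1 * ‖a p.1‖ * (β p.2.1 * ‖a p.2.1‖ * ‖a p.2.2‖)) := by
    refine (norm_tsum_le_tsum_norm (summable_norm_cubicForm hK a)).trans ?_
    refine (summable_norm_cubicForm hK a).tsum_le_tsum (fun p => ?_) hS
    rw [norm_cubicForm_term]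
    refine (mul_le_mul_of_nonneg_right (hKβ p) (by positivity)).trans_eq ?_
    ring
  refine key.trans_eq ?_
  rw [tsum_mul_left, (s1.add s2).tsum_add s3, s1.tsum_add s2, e1, e2, e3]
  ring

theorem norm_mul_conj_mul_sub_le (x y z x' y' z' : ℂ) :
    ‖x * (conj y * z) - x' * (conj y' * z')‖
      ≤ ‖x - x'‖ * (‖y‖ * ‖z‖) + ‖x'‖ * (‖y - y'‖ * ‖z‖) + ‖x'‖ * (‖y'‖ * ‖z - z'‖) := by
  have e : x * (conj y * z) - x' * (conj y' * z')
      = (x - x') * (conj y * z) + x' * (conj (y - y') * z) + x' * (conj y' * (z - z')) := by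
    rw [map_sub]; ring
  rw [e]
  refine (norm_add₃_le).trans_eq ?_
  simp only [norm_mul, RCLike.norm_conj]

theorem norm_cubicForm_sub_le {K : ℤ × ℤ × ℤ → ℂ} {C : ℝ} (hK : ∀ p, ‖K p‖ ≤ C)
    {a b : SummableCoeffs} {R : ℝ} (ha : ‖a‖ ≤ R) (hb : ‖b‖ ≤ R) :
    ‖cubicForm K a - cubicForm K b‖ ≤ 3 * C * R ^ 2 * ‖a - b‖ := by
  have hC : 0 ≤ C := (norm_nonneg _).trans (hK 0)
  have hR : 0 ≤ R := (norm_nonneg _).trans ha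
  have h0 : ∀ (c : SummableCoeffs) (n : ℤ), 0 ≤ ‖c n‖ := fun _ _ => norm_nonneg _
  have s1 := summable_mul_three (a - b).summable_norm a.summable_norm a.summable_norm
    (h0 _) (h0 _) (h0 _)
  have s2 := summable_mul_three b.summable_norm (a - b).summable_norm a.summable_norm
    (h0 _) (h0 _) (h0 _)
  have s3 := summable_mul_three b.summable_norm b.summable_norm (a - b).summable_norm
    (h0 _) (h0 _) (h0 _)
  have e1 := tsum_mul_three (a - b).summable_norm a.summable_norm a.summable_norm
    (h0 _) (h0 _) (h0 _)
  have e2 := tsum_mul_three b.summable_norm (a - b).summable_norm a.summable_norm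
    (h0 _) (h0 _) (h0 _)
  have e3 := tsum_mul_three b.summable_norm b.summable_norm (a - b).summable_norm
    (h0 _) (h0 _) (h0 _)
  simp only [← SummableCoeffs.norm_eq_tsum] at e1 e2 e3
  have hd := (hasSum_cubicForm hK a).sub (hasSum_cubicForm hK b)
  rw [← hd.tsum_eq]
  refine (tsum_of_norm_bounded (((s1.add s2).add s3).mul_left C).hasSum fun p => ?_).trans ?_
  · rw [← lp.single_sub, lp.norm_single (by norm_num), ← mul_sub, norm_mul]
    exact mul_le_mul (hK p) (norm_mul_conj_mul_sub_le _ _ _ _ _ _) (norm_nonneg _) hC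
  · rw [tsum_mul_left, (s1.add s2).tsum_add s3, s1.tsum_add s2, e1, e2, e3]
    have t1 : ‖a - b‖ * (‖a‖ * ‖a‖) ≤ ‖a - b‖ * (R * R) := by gcongr
    have t2 : ‖b‖ * (‖a - b‖ * ‖a‖) ≤ R * (‖a - b‖ * R) := by gcongr
    have t3 : ‖b‖ * (‖b‖ * ‖a - b‖) ≤ R * (R * ‖a - b‖) := by gcongr
    refine (mul_le_mul_of_nonneg_left (add_le_add (add_le_add t1 t2) t3) hC).trans_eq ?_
    ring

theorem continuous_cubicForm {K : ℝ → ℤ × ℤ × ℤ → ℂ} {C : ℝ} (hK : ∀ t p, ‖K t p‖ ≤ C)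
    (hc : ∀ p, Continuous fun t => K t p) (a : SummableCoeffs) :
    Continuous fun t => cubicForm (K t) a := by
  refine continuous_tsum
    (u := fun p : ℤ × ℤ × ℤ => C * (‖a p.1‖ * (‖a p.2.1‖ * ‖a p.2.2‖))) (fun p => ?_) ?_ ?_
  · exact (lp.isometry_single _).continuous.comp ((hc p).mul continuous_const)
  · exact (summable_mul_three a.summable_norm a.summable_norm a.summable_norm
      (fun _ => norm_nonneg _) (fun _ => norm_nonneg _) (fun _ => norm_nonneg _)).mul_left C
  · intro p t
    rw [norm_cubicForm_term]
    gcongr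
    exact hK t p

/-- The coefficients of a cubic form, the sum being parametrized by `(j, k)`, with
`i = n + j - k`. -/
theorem hasSum_cubicForm_apply {K : ℤ × ℤ × ℤ → ℂ} {C : ℝ} (hK : ∀ p, ‖K p‖ ≤ C)
    (a : SummableCoeffs) (n : ℤ) :
    HasSum (fun q : ℤ × ℤ => K (n + q.1 - q.2, q.1, q.2) *
      (a (n + q.1 - q.2) * (starRingEnd ℂ (a q.1) * a q.2))) (cubicForm K a n) := by
  have h := (hasSum_cubicForm hK a).map (lp.evalCLM ℂ (fun _ : ℤ => ℂ) 1 n)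
    (lp.evalCLM ℂ (fun _ : ℤ => ℂ) 1 n).continuous
  set ι : ℤ × ℤ → ℤ × ℤ × ℤ := fun q => (n + q.1 - q.2, q.1, q.2) with hι
  have hinj : Function.Injective ι := fun q q' hq => (Prod.ext_iff.1 hq).2
  rw [← hinj.hasSum_iff] at h
  · change HasSum _ (cubicForm K a n) at h
    convert h using 2 with q
    simp only [Function.comp_apply, hι]
    change _ = lp.single (E := fun _ : ℤ => ℂ) 1 (n + q.1 - q.2 - q.1 + q.2) _ n
    rw [show n + q.1 - q.2 - q.1 + q.2 = n by ring]
    exact (lp.single_apply_self (E := fun _ : ℤ => ℂ) _ _ _).symm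
  · intro p hp
    refine lp.single_apply_ne (E := fun _ : ℤ => ℂ) 1 _ _ fun hn => hp ⟨p.2, ?_⟩
    exact Prod.ext (by simp only [hι, hn]; ring) rfl

/-- A cubic form is Lipschitz in the supremum norm of the coefficients, with a constant depending
on their sums only. -/
theorem norm_cubicForm_apply_sub_le {K : ℤ × ℤ × ℤ → ℂ} {C : ℝ} (hK : ∀ p, ‖K p‖ ≤ C)
    {a b : SummableCoeffs} {M S : ℝ} (ha : ‖a‖ ≤ M) (hb : ‖b‖ ≤ M)
    (hS : ∀ n, ‖a n - b n‖ ≤ S) (n : ℤ) :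
    ‖cubicForm K a n - cubicForm K b n‖ ≤ 3 * C * M ^ 2 * S := by
  have hC : 0 ≤ C := (norm_nonneg _).trans (hK 0)
  have hM : 0 ≤ M := (norm_nonneg _).trans ha
  have hS0 : 0 ≤ S := (norm_nonneg _).trans (hS 0)
  have h0 : ∀ (c d : SummableCoeffs) (q : ℤ × ℤ), 0 ≤ ‖c q.1‖ * ‖d q.2‖ :=
    fun _ _ _ => by positivity
  have hs : ∀ c d : SummableCoeffs, Summable fun q : ℤ × ℤ => ‖c q.1‖ * ‖d q.2‖ := fun c d =>
    c.summable_norm.mul_of_nonneg d.summable_norm (fun _ => norm_nonneg _) fun _ => norm_nonneg _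
  have hle : ∀ c d : SummableCoeffs, ‖c‖ ≤ M → ‖d‖ ≤ M →
      ∑' q : ℤ × ℤ, ‖c q.1‖ * ‖d q.2‖ ≤ M ^ 2 := by
    intro c d hc hd
    rw [← c.summable_norm.tsum_mul_tsum d.summable_norm (hs c d), ← c.norm_eq_tsum,
      ← d.norm_eq_tsum, sq]
    gcongr
  have i2 : Function.Injective fun q : ℤ × ℤ => (n + q.1 - q.2, q.2) := by
    rintro ⟨j, k⟩ ⟨j', k'⟩ h
    simp only [Prod.mk.injEq] at h ⊢
    omega
  have i3 : Function.Injective fun q : ℤ × ℤ => (n + q.1 - q.2, q.1) := by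
    rintro ⟨j, k⟩ ⟨j', k'⟩ h
    simp only [Prod.mk.injEq] at h ⊢
    omega
  have s1 := hs a a
  have s2 := (hs b a).comp_injective i2
  have s3 := (hs b b).comp_injective i3
  have l2 := (tsum_comp_le_tsum_of_inj (hs b a) (h0 b a) i2).trans (hle b a hb ha)
  have l3 := (tsum_comp_le_tsum_of_inj (hs b b) (h0 b b) i3).trans (hle b b hb hb)
  simp only [Function.comp_def] at s2 s3 l2 l3
  have hd := (hasSum_cubicForm_apply hK a n).sub (hasSum_cubicForm_apply hK b n)
  rw [← hd.tsum_eq]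
  refine (tsum_of_norm_bounded (((s1.add s2).add s3).mul_left (C * S)).hasSum fun q => ?_).trans ?_
  · rw [← mul_sub, norm_mul, mul_assoc C]
    refine mul_le_mul (hK _) ((norm_mul_conj_mul_sub_le _ _ _ _ _ _).trans ?_) (norm_nonneg _) hC
    have t1 : ‖a (n + q.1 - q.2) - b (n + q.1 - q.2)‖ * (‖a q.1‖ * ‖a q.2‖)
        ≤ S * (‖a q.1‖ * ‖a q.2‖) := by
      gcongr; exact hS _
    have t2 : ‖b (n + q.1 - q.2)‖ * (‖a q.1 - b q.1‖ * ‖a q.2‖)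
        ≤ ‖b (n + q.1 - q.2)‖ * (S * ‖a q.2‖) := by
      gcongr; exact hS _
    have t3 : ‖b (n + q.1 - q.2)‖ * (‖b q.1‖ * ‖a q.2 - b q.2‖)
        ≤ ‖b (n + q.1 - q.2)‖ * (‖b q.1‖ * S) := by
      gcongr; exact hS _
    refine (add_le_add (add_le_add t1 t2) t3).trans_eq ?_
    ring
  · rw [tsum_mul_left, (s1.add s2).tsum_add s3, s1.tsum_add s2]
    refine (mul_le_mul_of_nonneg_left (add_le_add (add_le_add (hle a a ha ha) l2) l3)
      (mul_nonneg hC hS0)).trans_eq ?_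
    ring

/-- Convolution of coefficients is multiplication of functions. -/
theorem fourierSynthesis_cubicForm {K : ℤ × ℤ × ℤ → ℂ} {C : ℝ} (hK : ∀ p, ‖K p‖ ≤ C)
    {μ ν : Multiplier} {z : ℂ}
    (hμ : ∀ p : ℤ × ℤ × ℤ, μ (p.1 - p.2.1 + p.2.2) * K p
      = z * (ν p.1 * (conj (ν p.2.1) * ν p.2.2)))
    (a : SummableCoeffs) :
    fourierSynthesis μ (cubicForm K a)
      = planeWave 0 z * (fourierSynthesis ν a * (star (fourierSynthesis ν a)
        * fourierSynthesis ν a)) := by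
  have h := (hasSum_cubicForm hK a).map (fourierSynthesis μ) (fourierSynthesis μ).continuous
  have h1 := SummableCoeffs.summable_norm_planeWave ν a
  have h2 : Summable fun n => ‖star (planeWave n (ν n * a n))‖ := by
    simpa only [star_planeWave, norm_planeWave, RCLike.norm_conj] using h1
  have e2 : star (fourierSynthesis ν a) = ∑' n, star (planeWave n (ν n * a n)) :=
    (hasSum_fourierSynthesis ν a).star.tsum_eq.symm
  rw [e2, ← (hasSum_fourierSynthesis ν a).tsum_eq, tsum_mul_tsum_of_summable_norm h2 h1,
    tsum_mul_tsum_of_summable_norm h1 (h2.mul_norm h1), ← h.tsum_eq,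
    ← (summable_mul_of_summable_norm h1 (h2.mul_norm h1)).tsum_mul_left]
  refine tsum_congr fun p => ?_
  simp only [Function.comp_apply]
  rw [fourierSynthesis_single, star_planeWave, planeWave_mul, planeWave_mul, planeWave_mul,
    ← mul_assoc, hμ]
  congr 1
  · ring
  · rw [map_mul]; ring

end CubicForm

/-! ### The equation in weighted Fourier coefficients -/

noncomputable section SchrodingerField

open scoped ComplexConjugate

/-- The eigenvalue `(2πn)²` of `-∂ₓ²` at `e^{2πinx}`. -/
def laplaceEigenvalue (n : ℤ) : ℝ := (2 * Real.pi * n) ^ 2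

theorem laplaceEigenvalue_nonneg (n : ℤ) : 0 ≤ laplaceEigenvalue n := sq_nonneg _

theorem laplaceEigenvalue_le (n : ℤ) : laplaceEigenvalue n ≤ 40 * (1 + (n : ℝ) ^ 2) := by
  have hpi : Real.pi ^ 2 ≤ 10 := by
    have h1 := Real.pi_lt_d2
    have h0 := Real.pi_pos
    nlinarith
  have : laplaceEigenvalue n = 4 * Real.pi ^ 2 * (n : ℝ) ^ 2 := by
    rw [laplaceEigenvalue]; ring
  rw [this]
  nlinarith [sq_nonneg (n : ℝ)]

theorem sq_le_laplaceEigenvalue (n : ℤ) : (n : ℝ) ^ 2 ≤ laplaceEigenvalue n := by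
  have : laplaceEigenvalue n = 4 * Real.pi ^ 2 * (n : ℝ) ^ 2 := by
    rw [laplaceEigenvalue]; ring
  rw [this]
  have h1 : 1 ≤ 4 * Real.pi ^ 2 := by nlinarith [Real.pi_gt_three]
  nlinarith [sq_nonneg (n : ℝ)]

/-- The weight `(1 + n²)³`; summability against it makes the Schrödinger evolution of a function
three times differentiable in time. -/
def coeffWeight (n : ℤ) : ℝ := (1 + (n : ℝ) ^ 2) ^ 3

theorem one_le_coeffWeight (n : ℤ) : 1 ≤ coeffWeight n :=
  one_le_pow₀ (by nlinarith [sq_nonneg (n : ℝ)])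

theorem coeffWeight_pos (n : ℤ) : 0 < coeffWeight n := one_pos.trans_le (one_le_coeffWeight n)

theorem coeffWeight_le (i j k : ℤ) :
    coeffWeight (i - j + k) ≤ 243 * (coeffWeight i + coeffWeight j + coeffWeight k) := by
  have hm : ∀ x y z : ℝ, 0 ≤ x → 0 ≤ y → 0 ≤ z →
      (x + y + z) ^ 3 ≤ 9 * (x ^ 3 + y ^ 3 + z ^ 3) := by
    intro x y z hx hy hz
    nlinarith [mul_nonneg (add_nonneg hx hy) (sq_nonneg (x - y)),
      mul_nonneg (add_nonneg hy hz) (sq_nonneg (y - z)),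
      mul_nonneg (add_nonneg hx hz) (sq_nonneg (x - z)),
      mul_nonneg hx (sq_nonneg (y - z)), mul_nonneg hy (sq_nonneg (x - z)),
      mul_nonneg hz (sq_nonneg (x - y))]
  simp only [coeffWeight]
  push_cast
  have h1 : 1 + ((i : ℝ) - j + k) ^ 2
      ≤ 3 * ((1 + (i : ℝ) ^ 2) + (1 + (j : ℝ) ^ 2) + (1 + (k : ℝ) ^ 2)) := by
    nlinarith [sq_nonneg ((i : ℝ) + j), sq_nonneg ((j : ℝ) + k), sq_nonneg ((i : ℝ) - k)]
  calc (1 + ((i : ℝ) - j + k) ^ 2) ^ 3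
      ≤ (3 * ((1 + (i : ℝ) ^ 2) + (1 + (j : ℝ) ^ 2) + (1 + (k : ℝ) ^ 2))) ^ 3 :=
        pow_le_pow_left₀ (by positivity) h1 3
    _ = 27 * ((1 + (i : ℝ) ^ 2) + (1 + (j : ℝ) ^ 2) + (1 + (k : ℝ) ^ 2)) ^ 3 := by ring
    _ ≤ _ := by
        have := hm (1 + (i : ℝ) ^ 2) (1 + (j : ℝ) ^ 2) (1 + (k : ℝ) ^ 2) (by positivity)
          (by positivity) (by positivity)
        linarith

theorem norm_exp_mul_I_sub_one_sub_le (x : ℝ) :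
    ‖Complex.exp (x * Complex.I) - 1 - x * Complex.I‖ ≤ 2 * x ^ 2 := by
  have hx : ‖(x * Complex.I : ℂ)‖ = |x| := by simp
  rcases le_total |x| 1 with h | h
  · refine (Complex.norm_exp_sub_one_sub_id_le (by rwa [hx])).trans ?_
    rw [hx, sq_abs]
    nlinarith [sq_nonneg x]
  · have h1 : ‖Complex.exp (x * Complex.I) - 1‖ ≤ |x| := by
      rw [mul_comm]
      exact Real.norm_exp_I_mul_ofReal_sub_one_le
    refine (norm_sub_le _ _).trans ?_
    rw [hx]
    have : |x| ≤ |x| * |x| := le_mul_of_one_le_left (abs_nonneg _) h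
    rw [abs_mul_abs_self] at this
    nlinarith

/-- The multiplier `c(n) e^{i(2πn)²t}`: the propagator of `∂ₜu = -i∂ₓ²u`, composed with `c`. -/
def evolve (c : Multiplier) (t : ℝ) : Multiplier :=
  Multiplier.ofBounded (fun n => c n * Complex.exp ((laplaceEigenvalue n * t : ℝ) * Complex.I)) ‖c‖
    fun n => by
      rw [norm_mul, Complex.norm_exp_ofReal_mul_I, mul_one]
      exact c.norm_coe_le_norm n

theorem evolve_apply (c : Multiplier) (t : ℝ) (n : ℤ) :
    evolve c t n = c n * Complex.exp ((laplaceEigenvalue n * t : ℝ) * Complex.I) := rfl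

theorem norm_evolve_apply (c : Multiplier) (t : ℝ) (n : ℤ) : ‖evolve c t n‖ = ‖c n‖ := by
  rw [evolve_apply, norm_mul, Complex.norm_exp_ofReal_mul_I, mul_one]

/-- The evolution is differentiable in the norm of multipliers once two powers of the eigenvalues
are controlled. -/
theorem hasDerivAt_evolve {c d e : Multiplier}
    (hd : ∀ n, d n = Complex.I * laplaceEigenvalue n * c n)
    (he : ∀ n, e n = Complex.I * laplaceEigenvalue n * d n) (t : ℝ) :
    HasDerivAt (evolve c) (evolve d t) t := by
  rw [hasDerivAt_iff_isLittleO_nhds_zero]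
  refine (Asymptotics.IsBigO.of_bound (2 * ‖e‖) (Filter.Eventually.of_forall fun h => ?_)).trans_isLittleO
    (Asymptotics.isLittleO_pow_id one_lt_two)
  rw [BoundedContinuousFunction.norm_le (by positivity)]
  intro n
  have e1 : (evolve c (t + h) - evolve c t - h • evolve d t) n
      = c n * Complex.exp ((laplaceEigenvalue n * t : ℝ) * Complex.I)
        * (Complex.exp ((laplaceEigenvalue n * h : ℝ) * Complex.I) - 1
          - (laplaceEigenvalue n * h : ℝ) * Complex.I) := by
    simp only [BoundedContinuousFunction.coe_sub, BoundedContinuousFunction.coe_smul,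
      Pi.sub_apply, evolve_apply, hd, Complex.real_smul]
    rw [mul_add, Complex.ofReal_add, add_mul, Complex.exp_add]
    push_cast
    ring
  have e2 : ‖e n‖ = laplaceEigenvalue n ^ 2 * ‖c n‖ := by
    rw [he, hd]
    simp only [norm_mul, Complex.norm_I, Complex.norm_real, Real.norm_eq_abs,
      abs_of_nonneg (laplaceEigenvalue_nonneg n)]
    ring
  have hn := e.norm_coe_le_norm n
  rw [e2] at hn
  rw [e1, norm_mul, norm_mul, Complex.norm_exp_ofReal_mul_I, mul_one]
  calc ‖c n‖ * _ ≤ ‖c n‖ * (2 * (laplaceEigenvalue n * h) ^ 2) := by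
        gcongr
        exact norm_exp_mul_I_sub_one_sub_le _
    _ = 2 * (laplaceEigenvalue n ^ 2 * ‖c n‖) * h ^ 2 := by ring
    _ ≤ 2 * ‖e‖ * ‖h ^ 2‖ := by
        rw [Real.norm_eq_abs, abs_of_nonneg (sq_nonneg h)]
        gcongr

/-- The multiplier `(i (2πn)²)ʲ / (1 + n²)³`, bounded for `j ≤ 3`: it recovers a function from its
weighted coefficients and applies `(-i∂ₓ²)ʲ`. -/
def weightedSymbol (j : Fin 4) : Multiplier :=
  Multiplier.ofBounded
    (fun n => (Complex.I * laplaceEigenvalue n) ^ (j : ℕ) / coeffWeight n) (40 ^ (j : ℕ))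
    fun n => by
      rw [norm_div, norm_pow, norm_mul, Complex.norm_I, one_mul, Complex.norm_real,
        Complex.norm_real, Real.norm_of_nonneg (laplaceEigenvalue_nonneg n),
        Real.norm_of_nonneg (coeffWeight_pos n).le, div_le_iff₀ (coeffWeight_pos n)]
      calc laplaceEigenvalue n ^ (j : ℕ) ≤ (40 * (1 + (n : ℝ) ^ 2)) ^ (j : ℕ) :=
            pow_le_pow_left₀ (laplaceEigenvalue_nonneg n) (laplaceEigenvalue_le n) _
        _ = 40 ^ (j : ℕ) * (1 + (n : ℝ) ^ 2) ^ (j : ℕ) := mul_pow _ _ _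
        _ ≤ 40 ^ (j : ℕ) * coeffWeight n := by
            refine mul_le_mul_of_nonneg_left ?_ (by positivity)
            exact pow_le_pow_right₀ (by nlinarith [sq_nonneg (n : ℝ)]) (by omega)

theorem weightedSymbol_apply (j : Fin 4) (n : ℤ) :
    weightedSymbol j n = (Complex.I * laplaceEigenvalue n) ^ (j : ℕ) / coeffWeight n := rfl

theorem weightedSymbol_zero_apply (n : ℤ) :
    weightedSymbol 0 n = ((coeffWeight n)⁻¹ : ℝ) := by
  rw [weightedSymbol_apply]; simp

theorem weightedSymbol_succ (j : Fin 3) (n : ℤ) :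
    weightedSymbol j.succ n = Complex.I * laplaceEigenvalue n * weightedSymbol j.castSucc n := by
  rw [weightedSymbol_apply, weightedSymbol_apply]
  simp only [Fin.val_succ, Fin.val_castSucc, pow_succ]
  ring

/-- The kernel of the nonlinearity `iσ|u|²u` seen from the linear flow: `iσ` times the phase
`e^{iΦt}`, where `Φ` is the resonance function of the interaction of three frequencies. -/
def interactionKernel (σ t : ℝ) (p : ℤ × ℤ × ℤ) : ℂ :=
  Complex.I * σ * Complex.exp (((laplaceEigenvalue p.1 - laplaceEigenvalue p.2.1
    + laplaceEigenvalue p.2.2 - laplaceEigenvalue (p.1 - p.2.1 + p.2.2)) * t : ℝ) * Complex.I)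

theorem norm_interactionKernel (σ t : ℝ) (p : ℤ × ℤ × ℤ) : ‖interactionKernel σ t p‖ = |σ| := by
  rw [interactionKernel, norm_mul, Complex.norm_exp_ofReal_mul_I, mul_one, norm_mul,
    Complex.norm_I, one_mul, Complex.norm_real, Real.norm_eq_abs]

/-- The kernel of the nonlinearity for coefficients multiplied by the weight. -/
def weightedKernel (σ t : ℝ) (p : ℤ × ℤ × ℤ) : ℂ :=
  interactionKernel σ t p * ((coeffWeight (p.1 - p.2.1 + p.2.2) * ((coeffWeight p.1)⁻¹
    * ((coeffWeight p.2.1)⁻¹ * (coeffWeight p.2.2)⁻¹)) : ℝ) : ℂ)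

/-- The weight of the output frequency is at most a multiple of the sum of the input weights, so it
cancels one of them and leaves the inverses of the other two. -/
theorem norm_weightedKernel_le {σ : ℝ} (hσ : |σ| ≤ 1) (t : ℝ) (p : ℤ × ℤ × ℤ) :
    ‖weightedKernel σ t p‖ ≤ 243 * ((coeffWeight p.2.1)⁻¹ * (coeffWeight p.2.2)⁻¹
      + (coeffWeight p.1)⁻¹ * (coeffWeight p.2.2)⁻¹
      + (coeffWeight p.1)⁻¹ * (coeffWeight p.2.1)⁻¹) := by
  have h1 := coeffWeight_pos p.1
  have h2 := coeffWeight_pos p.2.1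
  have h3 := coeffWeight_pos p.2.2
  have h4 := coeffWeight_pos (p.1 - p.2.1 + p.2.2)
  rw [weightedKernel, norm_mul, norm_interactionKernel, Complex.norm_real,
    Real.norm_of_nonneg (by positivity)]
  refine (mul_le_of_le_one_left (by positivity) hσ).trans ?_
  refine (mul_le_mul_of_nonneg_right (coeffWeight_le p.1 p.2.1 p.2.2) (by positivity)).trans_eq ?_
  field_simp

theorem norm_weightedKernel_le_const {σ : ℝ} (hσ : |σ| ≤ 1) (t : ℝ) (p : ℤ × ℤ × ℤ) :
    ‖weightedKernel σ t p‖ ≤ 729 := by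
  refine (norm_weightedKernel_le hσ t p).trans ?_
  have hb : ∀ n, 0 ≤ (coeffWeight n)⁻¹ := fun n => (inv_pos.2 (coeffWeight_pos n)).le
  have h1 : ∀ m n, (coeffWeight m)⁻¹ * (coeffWeight n)⁻¹ ≤ 1 := fun m n =>
    mul_le_one₀ (inv_le_one_of_one_le₀ (one_le_coeffWeight m)) (hb n)
      (inv_le_one_of_one_le₀ (one_le_coeffWeight n))
  linarith [h1 p.2.1 p.2.2, h1 p.1 p.2.2, h1 p.1 p.2.1]

theorem continuous_weightedKernel (σ : ℝ) (p : ℤ × ℤ × ℤ) :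
    Continuous fun t => weightedKernel σ t p := by
  unfold weightedKernel interactionKernel
  fun_prop

theorem evolve_mul_interactionKernel (σ t : ℝ) (p : ℤ × ℤ × ℤ) :
    Complex.exp ((laplaceEigenvalue (p.1 - p.2.1 + p.2.2) * t : ℝ) * Complex.I)
      * interactionKernel σ t p
      = Complex.I * σ * (Complex.exp ((laplaceEigenvalue p.1 * t : ℝ) * Complex.I)
        * (conj (Complex.exp ((laplaceEigenvalue p.2.1 * t : ℝ) * Complex.I))
          * Complex.exp ((laplaceEigenvalue p.2.2 * t : ℝ) * Complex.I))) := by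
  rw [interactionKernel, mul_left_comm, ← Complex.exp_conj, ← Complex.exp_add, ← Complex.exp_add,
    ← Complex.exp_add]
  congr 2
  simp only [map_mul, Complex.conj_ofReal, Complex.conj_I]
  push_cast
  ring

/-- In weighted coefficients, seen from the linear flow, the cubic form of the weighted kernel
is the nonlinearity `iσ|U|²U`. -/
theorem fourierSynthesis_cubicForm_weightedKernel {σ : ℝ} (hσ : |σ| ≤ 1) (t : ℝ)
    (b : SummableCoeffs) :
    fourierSynthesis (evolve (weightedSymbol 0) t) (cubicForm (weightedKernel σ t) b)
      = planeWave 0 (Complex.I * σ) * (fourierSynthesis (evolve (weightedSymbol 0) t) b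
        * (star (fourierSynthesis (evolve (weightedSymbol 0) t) b)
          * fourierSynthesis (evolve (weightedSymbol 0) t) b)) := by
  refine fourierSynthesis_cubicForm (norm_weightedKernel_le_const hσ t) (fun p => ?_) b
  have h4 : (coeffWeight (p.1 - p.2.1 + p.2.2) : ℂ) ≠ 0 :=
    Complex.ofReal_ne_zero.2 (coeffWeight_pos _).ne'
  have e := evolve_mul_interactionKernel σ t p
  simp only [evolve_apply, weightedSymbol_zero_apply, weightedKernel, map_mul, Complex.conj_ofReal]
  calc _ = ((coeffWeight (p.1 - p.2.1 + p.2.2) : ℂ)⁻¹ * coeffWeight (p.1 - p.2.1 + p.2.2))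
        * (Complex.exp ((laplaceEigenvalue (p.1 - p.2.1 + p.2.2) * t : ℝ) * Complex.I)
          * interactionKernel σ t p) * ((coeffWeight p.1 : ℂ)⁻¹
    * ((coeffWeight p.2.1 : ℂ)⁻¹ * (coeffWeight p.2.2 : ℂ)⁻¹)) := by
        push_cast; ring
    _ = _ := by
        rw [inv_mul_cancel₀ h4, e]
        push_cast; ring

end SchrodingerField

/-! ### Conservation of mass and energy -/

noncomputable section Conservation

open scoped ComplexConjugate

/-- The function `U` at time `t` whose Fourier coefficients, multiplied by the weight and seen from
the linear flow, are `b`. If `b` depends on `t` through the equation with `weightedKernel`, it solves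
the Schrödinger equation. -/
def solutionAt (t : ℝ) (b : SummableCoeffs) : C(UnitAddCircle, ℂ) :=
  fourierSynthesis (evolve (weightedSymbol 0) t) b

/-- The linear part `-i∂ₓ²U` of `∂ₜU`. -/
def dispersionAt (t : ℝ) (b : SummableCoeffs) : C(UnitAddCircle, ℂ) :=
  fourierSynthesis (evolve (weightedSymbol 1) t) b

/-- The nonlinear part `iσ|U|²U` of `∂ₜU`. -/
def nonlinearityAt (σ t : ℝ) (b : SummableCoeffs) : C(UnitAddCircle, ℂ) :=
  planeWave 0 (Complex.I * σ) * (solutionAt t b * (star (solutionAt t b) * solutionAt t b))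

/-- The mass `∫ |U|²`. -/
def mass (t : ℝ) (b : SummableCoeffs) : ℝ :=
  (circleMean (star (solutionAt t b) * solutionAt t b)).re

/-- The kinetic energy `∫ |∂ₓU|²`, written as the imaginary part of `∫ Ū (-i∂ₓ²U)`. -/
def kineticEnergy (t : ℝ) (b : SummableCoeffs) : ℝ :=
  (circleMean (star (solutionAt t b) * dispersionAt t b)).im

/-- The quartic energy `∫ |U|⁴`. -/
def quarticEnergy (t : ℝ) (b : SummableCoeffs) : ℝ :=
  (circleMean (star (solutionAt t b) * solutionAt t b
    * (star (solutionAt t b) * solutionAt t b))).re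

theorem hasDerivAt_solutionAt {σ : ℝ} (hσ : |σ| ≤ 1) {b : ℝ → SummableCoeffs} {t : ℝ}
    (hb : HasDerivAt b (cubicForm (weightedKernel σ t) (b t)) t) :
    HasDerivAt (fun t => solutionAt t (b t))
      (dispersionAt t (b t) + nonlinearityAt σ t (b t)) t := by
  have h := fourierSynthesis.hasDerivAt_of_bilinear
    (fun _ => hasDerivAt_evolve (weightedSymbol_succ 0) (weightedSymbol_succ 1) t) fun _ => hb
  rw [add_comm]
  refine h.congr_deriv ?_
  exact congrArg (· + _) (fourierSynthesis_cubicForm_weightedKernel hσ t (b t))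

theorem hasDerivAt_dispersionAt {b : ℝ → SummableCoeffs} {t : ℝ} {b' : SummableCoeffs}
    (hb : HasDerivAt b b' t) :
    HasDerivAt (fun t => dispersionAt t (b t))
      (fourierSynthesis (evolve (weightedSymbol 1) t) b'
        + fourierSynthesis (evolve (weightedSymbol 2) t) (b t)) t :=
  fourierSynthesis.hasDerivAt_of_bilinear
    (fun _ => hasDerivAt_evolve (weightedSymbol_succ 1) (weightedSymbol_succ 2) t) fun _ => hb

theorem evolve_weightedSymbol_succ (j : Fin 3) (t : ℝ) (n : ℤ) :
    evolve (weightedSymbol j.succ) t n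
      = Complex.I * laplaceEigenvalue n * evolve (weightedSymbol j.castSucc) t n := by
  rw [evolve_apply, evolve_apply, weightedSymbol_succ]
  ring

theorem HasSum.congr_terms {ι M : Type*} [AddCommMonoid M] [TopologicalSpace M] {f g : ι → M}
    {a : M} (h : HasSum f a) (e : ∀ i, f i = g i) : HasSum g a :=
  funext e ▸ h

theorem norm_evolve_mul (c : Multiplier) (t : ℝ) (n : ℤ) (z : ℂ) :
    ‖evolve c t n * z‖ = ‖c n * z‖ := by
  rw [norm_mul, norm_mul, norm_evolve_apply]

theorem hasSum_mass (t : ℝ) (b : SummableCoeffs) :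
    HasSum (fun n => ‖weightedSymbol 0 n * b n‖ ^ 2) (mass t b) := by
  have h := (hasSum_circleMean_star_mul (evolve (weightedSymbol 0) t) (evolve (weightedSymbol 0) t)
    b b).mapL Complex.reCLM
  refine h.congr_terms fun n => ?_
  rw [Complex.conj_mul', norm_evolve_mul, ← Complex.ofReal_pow]
  exact Complex.ofReal_re _

theorem hasSum_circleMean_star_mul_dispersionAt (t : ℝ) (b : SummableCoeffs) :
    HasSum (fun n => Complex.I * ((laplaceEigenvalue n * ‖weightedSymbol 0 n * b n‖ ^ 2 : ℝ) : ℂ))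
      (circleMean (star (solutionAt t b) * dispersionAt t b)) := by
  refine (hasSum_circleMean_star_mul (evolve (weightedSymbol 0) t)
    (evolve (weightedSymbol 1) t) b b).congr_terms fun n => ?_
  have e : evolve (weightedSymbol 1) t n * b n
      = Complex.I * laplaceEigenvalue n * (evolve (weightedSymbol 0) t n * b n) := by
    rw [← mul_assoc]
    exact congrArg (· * _) (evolve_weightedSymbol_succ 0 t n)
  rw [e, mul_left_comm, Complex.conj_mul', norm_evolve_mul]
  push_cast
  ring

theorem hasSum_kineticEnergy (t : ℝ) (b : SummableCoeffs) :
    HasSum (fun n => laplaceEigenvalue n * ‖weightedSymbol 0 n * b n‖ ^ 2)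
      (kineticEnergy t b) := by
  refine ((hasSum_circleMean_star_mul_dispersionAt t b).mapL Complex.imCLM).congr_terms
    fun n => ?_
  rw [Complex.imCLM_apply, Complex.I_mul_im, Complex.ofReal_re]

theorem re_circleMean_star_mul_dispersionAt (t : ℝ) (b : SummableCoeffs) :
    (circleMean (star (solutionAt t b) * dispersionAt t b)).re = 0 := by
  have h := (hasSum_circleMean_star_mul_dispersionAt t b).mapL Complex.reCLM
  have e : (fun n => Complex.reCLM
      (Complex.I * ((laplaceEigenvalue n * ‖weightedSymbol 0 n * b n‖ ^ 2 : ℝ) : ℂ)))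
      = fun _ => 0 := by
    funext n
    rw [Complex.reCLM_apply, Complex.I_mul_re, Complex.ofReal_im, neg_zero]
  rw [e] at h
  exact h.unique hasSum_zero

/-- The Laplacian is symmetric: `-i∂ₓ²` may be moved to the other factor, with a sign. -/
theorem circleMean_star_mul_eq_neg {μ μ' ν ν' : Multiplier}
    (hμ : ∀ n, μ' n = Complex.I * laplaceEigenvalue n * μ n)
    (hν : ∀ n, ν' n = Complex.I * laplaceEigenvalue n * ν n) (a b : SummableCoeffs) :
    circleMean (star (fourierSynthesis μ a) * fourierSynthesis ν' b)
      = -circleMean (star (fourierSynthesis μ' a) * fourierSynthesis ν b) := by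
  rw [← (hasSum_circleMean_star_mul μ ν' a b).tsum_eq,
    ← (hasSum_circleMean_star_mul μ' ν a b).neg.tsum_eq]
  refine tsum_congr fun n => ?_
  rw [hμ, hν]
  simp only [map_mul, Complex.conj_I, Complex.conj_ofReal]
  ring

theorem circleMean_star_mul_comm (f g : C(UnitAddCircle, ℂ)) :
    circleMean (star g * f) = conj (circleMean (star f * g)) := by
  rw [← circleMean_star, star_mul, star_star]

theorem im_circleMean_of_star_eq {f : C(UnitAddCircle, ℂ)} (hf : star f = f) :
    (circleMean f).im = 0 := by
  have := circleMean_star f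
  rw [hf] at this
  exact Complex.conj_eq_iff_im.1 this.symm

/-- The mass is conserved. -/
theorem hasDerivAt_mass {σ : ℝ} (hσ : |σ| ≤ 1) {b : ℝ → SummableCoeffs} {t : ℝ}
    (hb : HasDerivAt b (cubicForm (weightedKernel σ t) (b t)) t) :
    HasDerivAt (fun t => mass t (b t)) 0 t := by
  have hU := hasDerivAt_solutionAt hσ hb
  have h := Complex.reCLM.hasFDerivAt.comp_hasDerivAt t
    (circleMean.hasFDerivAt.comp_hasDerivAt t (hU.star.mul hU))
  refine h.congr_deriv ?_
  set U := solutionAt t (b t) with hUdef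
  set W := dispersionAt t (b t) with hWdef
  have h1 : (circleMean (star U * W)).re = 0 := re_circleMean_star_mul_dispersionAt t (b t)
  have h2 : (circleMean (star U * nonlinearityAt σ t (b t))).re = 0 := by
    have e : star U * nonlinearityAt σ t (b t)
        = planeWave 0 (Complex.I * σ) * (star U * U * (star U * U)) := by
      rw [nonlinearityAt, ← hUdef]; ring
    rw [e, circleMean_planeWave_zero_mul, mul_assoc, Complex.I_mul_re, Complex.im_ofReal_mul,
      im_circleMean_of_star_eq (by rw [star_mul, star_mul, star_star]), mul_zero, neg_zero]
  rw [Complex.reCLM_apply, map_add, Complex.add_re, circleMean_star_mul_comm U, Complex.conj_re,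
    mul_add, map_add, Complex.add_re, h1, h2]
  norm_num

/-- The energy `∫ |∂ₓU|² + (σ/2) ∫ |U|⁴` is conserved. -/
theorem hasDerivAt_energy {σ : ℝ} (hσ : |σ| ≤ 1) {b : ℝ → SummableCoeffs} {t : ℝ}
    (hb : HasDerivAt b (cubicForm (weightedKernel σ t) (b t)) t) :
    HasDerivAt (fun t => kineticEnergy t (b t) + σ / 2 * quarticEnergy t (b t)) 0 t := by
  have hU := hasDerivAt_solutionAt hσ hb
  have hW := hasDerivAt_dispersionAt hb
  have hk := Complex.imCLM.hasFDerivAt.comp_hasDerivAt t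
    (circleMean.hasFDerivAt.comp_hasDerivAt t (hU.star.mul hW))
  have hQ : HasDerivAt (fun t => star (solutionAt t (b t)) * solutionAt t (b t)) _ t :=
    hU.star.mul hU
  have hq := Complex.reCLM.hasFDerivAt.comp_hasDerivAt t
    (circleMean.hasFDerivAt.comp_hasDerivAt t (hQ.fun_mul hQ))
  refine (hk.add (hq.const_mul (σ / 2))).congr_deriv ?_
  set U := solutionAt t (b t) with hUdef
  set W := dispersionAt t (b t) with hWdef
  set N := nonlinearityAt σ t (b t) with hNdef
  set F := cubicForm (weightedKernel σ t) (b t) with hFdef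
  set W' := fourierSynthesis (evolve (weightedSymbol 1) t) F
        + fourierSynthesis (evolve (weightedSymbol 2) t) (b t) with hW'
  have hN : N = fourierSynthesis (evolve (weightedSymbol 0) t) F :=
    (fourierSynthesis_cubicForm_weightedKernel hσ t (b t)).symm
  -- The Laplacian is moved from the time derivative of `W` to the other factor.
  have e1 : circleMean (star U * W') = -circleMean (star W * (W + N)) := by
    have a1 : circleMean (star U * fourierSynthesis (evolve (weightedSymbol 1) t) F)
        = -circleMean (star W * fourierSynthesis (evolve (weightedSymbol 0) t) F) :=
      circleMean_star_mul_eq_neg (evolve_weightedSymbol_succ 0 t) (evolve_weightedSymbol_succ 0 t)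
        (b t) F
    have a2 : circleMean (star U * fourierSynthesis (evolve (weightedSymbol 2) t) (b t))
        = -circleMean (star W * W) :=
      circleMean_star_mul_eq_neg (evolve_weightedSymbol_succ 0 t) (evolve_weightedSymbol_succ 1 t)
        (b t) (b t)
    rw [hW', mul_add, map_add, a1, a2, mul_add, map_add, hN]
    ring
  have e2 : (circleMean (star (W + N) * W + star U * W')).im
      = 2 * (circleMean (star (W + N) * W)).im := by
    rw [map_add, e1, circleMean_star_mul_comm (W + N) W, Complex.add_im, Complex.neg_im,
      Complex.conj_im]
    ring
  set ξ := circleMean (star (W + N) * (U * (star U * U))) with hξ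
  have e3 : (circleMean ((star (W + N) * U + star U * (W + N)) * (star U * U)
      + star U * U * (star (W + N) * U + star U * (W + N)))).re = 4 * ξ.re := by
    have : (star (W + N) * U + star U * (W + N)) * (star U * U)
      + star U * U * (star (W + N) * U + star U * (W + N))
      = (star (W + N) * (U * (star U * U)) + star (U * (star U * U)) * (W + N))
        + (star (W + N) * (U * (star U * U)) + star (U * (star U * U)) * (W + N)) := by
      simp only [star_mul, star_star]
      ring
    rw [this, map_add, map_add, circleMean_star_mul_comm (W + N), ← hξ]
    simp only [Complex.add_re, Complex.conj_re]
    ring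
  have e4 : (circleMean (star (W + N) * N)).im = σ * ξ.re := by
    have : star (W + N) * N
        = planeWave 0 (Complex.I * σ) * (star (W + N) * (U * (star U * U))) := by
      rw [hNdef, nonlinearityAt, ← hUdef]; ring
    rw [this, circleMean_planeWave_zero_mul, ← hξ, mul_assoc, Complex.I_mul_im,
      Complex.re_ofReal_mul]
  -- The two contributions cancel, as `∫ |W + N|²` is real.
  have e5 : (circleMean (star (W + N) * W)).im + (circleMean (star (W + N) * N)).im = 0 := by
    rw [← Complex.add_im, ← map_add, ← mul_add]
    exact im_circleMean_of_star_eq (by rw [star_mul, star_star])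
  rw [Complex.imCLM_apply, Complex.reCLM_apply, e2, e3]
  rw [e4] at e5
  linarith

end Conservation

/-! ### A priori bounds and global solutions -/

noncomputable section GlobalSolutions

open Set

/-- The Gagliardo-Nirenberg type inequality behind global existence: the sum of the Fourier
coefficients is controlled by the mass and an arbitrarily small multiple of the kinetic energy. -/
theorem exists_tsum_sq_le_mass_add_kineticEnergy {η : ℝ} (hη : 0 < η) :
    ∃ C : ℝ, 0 ≤ C ∧ ∀ (x : ℤ → ℝ) (M E : ℝ), (∀ n, 0 ≤ x n) →
      HasSum (fun n => x n ^ 2) M → HasSum (fun n => laplaceEigenvalue n * x n ^ 2) E →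
      (∑' n, x n) ^ 2 ≤ C * M + η * E := by
  have hsum : Summable fun n : ℤ => 1 / (n : ℝ) ^ 2 :=
    Real.summable_one_div_int_pow.2 one_lt_two
  -- Outside a finite set `s`, the Cauchy-Schwarz inequality gains from `∑ 1 / n²`.
  obtain ⟨s, hs⟩ := summable_iff_vanishing_norm.1 hsum (η / 2) (by positivity)
  set S := insert 0 s with hS
  refine ⟨2 * S.card, by positivity, fun x M E hx hM hE => ?_⟩
  have hM0 : 0 ≤ M := hM.nonneg fun n => sq_nonneg _
  have hE0 : 0 ≤ E := hE.nonneg fun n => mul_nonneg (laplaceEigenvalue_nonneg n) (sq_nonneg _)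
  have hbound : ∀ F : Finset ℤ, (∑ n ∈ F, x n) ^ 2 ≤ 2 * S.card * M + η * E := by
    intro F
    have h1 : ∑ n ∈ F, x n ≤ ∑ n ∈ S, x n + ∑ n ∈ F \ S, x n := by
      rw [← Finset.sum_union Finset.disjoint_sdiff, Finset.union_sdiff_self_eq_union]
      exact Finset.sum_le_sum_of_subset_of_nonneg Finset.subset_union_right fun n _ _ => hx n
    have h2 : (∑ n ∈ S, x n) ^ 2 ≤ S.card * M :=
      sq_sum_le_card_mul_sum_sq.trans
        (mul_le_mul_of_nonneg_left (sum_le_hasSum _ (fun n _ => sq_nonneg _) hM) (by positivity))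
    have h3 : (∑ n ∈ F \ S, x n) ^ 2 ≤ η / 2 * E := by
      have hcs := Finset.sum_sq_le_sum_mul_sum_of_sq_le_mul (F \ S) (r := x)
        (f := fun n : ℤ => 1 / (n : ℝ) ^ 2) (g := fun n : ℤ => (n : ℝ) ^ 2 * x n ^ 2)
        (fun n _ => by positivity) (fun n _ => by positivity) (fun n hn => le_of_eq <| by
          have hn0 : (n : ℝ) ≠ 0 := by
            rintro h
            have : n = 0 := by exact_mod_cast h
            simp [hS, this] at hn
          field_simp)
      refine hcs.trans (mul_le_mul ?_ ?_ (Finset.sum_nonneg fun n _ => by positivity)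
        (by positivity))
      · refine (le_abs_self _).trans (hs _ ?_).le
        exact Finset.disjoint_of_subset_right (Finset.subset_insert 0 s) Finset.sdiff_disjoint
      · refine (Finset.sum_le_sum fun n _ => ?_).trans
          (sum_le_hasSum (F \ S)
            (fun n _ => mul_nonneg (laplaceEigenvalue_nonneg n) (sq_nonneg _)) hE)
        exact mul_le_mul_of_nonneg_right (sq_le_laplaceEigenvalue n) (sq_nonneg _)
    have h0 : 0 ≤ ∑ n ∈ F, x n := Finset.sum_nonneg fun n _ => hx n
    nlinarith [sq_nonneg (∑ n ∈ S, x n - ∑ n ∈ F \ S, x n)]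
  have hle : ∑' n, x n ≤ Real.sqrt (2 * S.card * M + η * E) :=
    Real.tsum_le_of_sum_le hx fun F => Real.le_sqrt_of_sq_le (hbound F)
  calc (∑' n, x n) ^ 2 ≤ Real.sqrt (2 * S.card * M + η * E) ^ 2 :=
        pow_le_pow_left₀ (tsum_nonneg hx) hle 2
    _ = _ := Real.sq_sqrt (by positivity)

theorem re_circleMean_eq_integral {f : C(UnitAddCircle, ℂ)} {g : UnitAddCircle → ℝ}
    (h : ∀ x, f x = g x) : (circleMean f).re = ∫ x, g x ∂AddCircle.haarAddCircle := by
  rw [circleMean_apply]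
  simp only [h]
  exact (congrArg Complex.re integral_complex_ofReal).trans (Complex.ofReal_re _)

theorem mass_eq_integral (t : ℝ) (b : SummableCoeffs) :
    mass t b = ∫ x, ‖solutionAt t b x‖ ^ 2 ∂AddCircle.haarAddCircle := by
  refine re_circleMean_eq_integral fun x => ?_
  rw [ContinuousMap.mul_apply, ContinuousMap.star_apply, Complex.star_def, Complex.conj_mul']
  push_cast
  rfl

theorem quarticEnergy_eq_integral (t : ℝ) (b : SummableCoeffs) :
    quarticEnergy t b = ∫ x, ‖solutionAt t b x‖ ^ 4 ∂AddCircle.haarAddCircle := by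
  refine re_circleMean_eq_integral fun x => ?_
  simp only [ContinuousMap.mul_apply, ContinuousMap.star_apply, Complex.star_def,
    Complex.conj_mul']
  push_cast
  ring

theorem quarticEnergy_nonneg (t : ℝ) (b : SummableCoeffs) : 0 ≤ quarticEnergy t b := by
  rw [quarticEnergy_eq_integral]
  exact MeasureTheory.integral_nonneg fun x => by positivity

theorem quarticEnergy_le (t : ℝ) (b : SummableCoeffs) :
    quarticEnergy t b ≤ (∑' n, ‖weightedSymbol 0 n * b n‖) ^ 2 * mass t b := by
  rw [quarticEnergy_eq_integral, mass_eq_integral, ← MeasureTheory.integral_const_mul]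
  have hU : ∀ x, ‖solutionAt t b x‖ ≤ ∑' n, ‖weightedSymbol 0 n * b n‖ := fun x => by
    refine ((solutionAt t b).norm_coe_le_norm x).trans ((norm_fourierSynthesis_le _ b).trans_eq ?_)
    exact tsum_congr fun n => norm_evolve_mul _ t n _
  have hi : ∀ f : UnitAddCircle → ℝ, Continuous f →
      MeasureTheory.Integrable f AddCircle.haarAddCircle := fun f hf =>
    hf.integrable_of_hasCompactSupport (HasCompactSupport.of_compactSpace _)
  refine MeasureTheory.integral_mono (hi _ (by fun_prop)) (hi _ (by fun_prop)) fun x => ?_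
  have h1 := pow_le_pow_left₀ (norm_nonneg _) (hU x) 2
  calc ‖solutionAt t b x‖ ^ 4 = ‖solutionAt t b x‖ ^ 2 * ‖solutionAt t b x‖ ^ 2 := by ring
    _ ≤ _ := mul_le_mul_of_nonneg_right h1 (by positivity)

/-- By conservation of mass and energy, the Fourier coefficients of a solution have a sum bounded
by its initial values, on whichever interval the solution lives. -/
theorem exists_tsum_sq_le_of_solution {σ : ℝ} (hσ : |σ| ≤ 1) (b₀ : SummableCoeffs) :
    ∃ L : ℝ, 0 ≤ L ∧ ∀ T, 0 < T → ∀ b : ℝ → SummableCoeffs, b 0 = b₀ →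
      (∀ t ∈ Ioo (-T) T, HasDerivAt b (cubicForm (weightedKernel σ t) (b t)) t) →
      ∀ t ∈ Ioo (-T) T, (∑' n, ‖weightedSymbol 0 n * b t n‖) ^ 2 ≤ L := by
  set M := mass 0 b₀ with hM
  set E := kineticEnergy 0 b₀ + σ / 2 * quarticEnergy 0 b₀ with hE
  have hM0 : 0 ≤ M := (hasSum_mass 0 b₀).nonneg fun n => sq_nonneg _
  -- With this `η`, the quartic energy is at most `C M²` plus the kinetic energy, so that only half of
  -- the latter is lost in the focusing case.
  obtain ⟨C, hC, hGN⟩ := exists_tsum_sq_le_mass_add_kineticEnergy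
    (η := 1 / (M + 1)) (by positivity)
  refine ⟨C * M + (2 * |E| + C * M ^ 2), by positivity, fun T hT b hb0 hb t ht => ?_⟩
  have h0 : (0 : ℝ) ∈ Ioo (-T) T := ⟨by linarith, hT⟩
  have hmass : mass t (b t) = M := by
    have := isOpen_Ioo.is_const_of_deriv_eq_zero isPreconnected_Ioo
      (fun s hs => (hasDerivAt_mass hσ (hb s hs)).differentiableAt.differentiableWithinAt)
      (fun s hs => (hasDerivAt_mass hσ (hb s hs)).deriv) ht h0
    rw [this, hb0]
  have henergy : kineticEnergy t (b t) + σ / 2 * quarticEnergy t (b t) = E := by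
    have := isOpen_Ioo.is_const_of_deriv_eq_zero isPreconnected_Ioo
      (fun s hs => (hasDerivAt_energy hσ (hb s hs)).differentiableAt.differentiableWithinAt)
      (fun s hs => (hasDerivAt_energy hσ (hb s hs)).deriv) ht h0
    rw [this, hb0]
  have hk0 : 0 ≤ kineticEnergy t (b t) :=
    (hasSum_kineticEnergy t (b t)).nonneg fun n =>
      mul_nonneg (laplaceEigenvalue_nonneg n) (sq_nonneg _)
  have hgn := hGN (fun n => ‖weightedSymbol 0 n * b t n‖) M (kineticEnergy t (b t))
    (fun n => norm_nonneg _) (hmass ▸ hasSum_mass t (b t)) (hasSum_kineticEnergy t (b t))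
  have hP0 := quarticEnergy_nonneg t (b t)
  have hP := quarticEnergy_le t (b t)
  rw [hmass] at hP
  set ℓ := (∑' n, ‖weightedSymbol 0 n * b t n‖) ^ 2
  set k := kineticEnergy t (b t)
  set P := quarticEnergy t (b t)
  have h1 : k ≤ |E| + P / 2 := by
    have h2 : -P ≤ σ * P := by nlinarith [(abs_le.1 hσ).1]
    linarith [le_abs_self E]
  have h2 : 1 / (M + 1) * k * M ≤ k := by
    rw [div_mul_eq_mul_div, one_mul, div_mul_eq_mul_div, div_le_iff₀ (by positivity)]
    nlinarith
  have h3 : 1 / (M + 1) * k ≤ k := by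
    rw [div_mul_eq_mul_div, one_mul, div_le_iff₀ (by positivity)]
    nlinarith
  have h4 : ℓ * M ≤ (C * M + 1 / (M + 1) * k) * M := mul_le_mul_of_nonneg_right hgn hM0
  nlinarith

/-- Grönwall's inequality, in both directions of time. -/
theorem norm_le_mul_exp_of_norm_deriv_le {E : Type*} [NormedAddCommGroup E] [NormedSpace ℝ E]
    {b b' : ℝ → E} {T D : ℝ} (hb : ∀ t ∈ Ioo (-T) T, HasDerivAt b (b' t) t)
    (hD : ∀ t ∈ Ioo (-T) T, ‖b' t‖ ≤ D * ‖b t‖) {t : ℝ} (ht : t ∈ Ioo (-T) T) :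
    ‖b t‖ ≤ ‖b 0‖ * Real.exp (D * |t|) := by
  have forward : ∀ (c c' : ℝ → E), (∀ t ∈ Ioo (-T) T, HasDerivAt c (c' t) t) →
      (∀ t ∈ Ioo (-T) T, ‖c' t‖ ≤ D * ‖c t‖) → ∀ t ∈ Ioo (-T) T, 0 ≤ t →
      ‖c t‖ ≤ ‖c 0‖ * Real.exp (D * t) := by
    intro c c' hc hcD t ht ht0
    have hsub : ∀ s ∈ Icc 0 t, s ∈ Ioo (-T) T := fun s hs =>
      ⟨by linarith [hs.1, ht.1, ht.2], hs.2.trans_lt ht.2⟩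
    have := norm_le_gronwallBound_of_norm_deriv_right_le (f := c) (f' := c') (K := D) (ε := 0)
      (fun s hs => (hc s (hsub s hs)).continuousAt.continuousWithinAt)
      (fun s hs => (hc s (hsub s (Ico_subset_Icc_self hs))).hasDerivWithinAt) le_rfl
      (fun s hs => by simpa using hcD s (hsub s (Ico_subset_Icc_self hs))) t ⟨ht0, le_rfl⟩
    rwa [gronwallBound_ε0, sub_zero] at this
  rcases le_total 0 t with h | h
  · rw [abs_of_nonneg h]
    exact forward b b' hb hD t ht h
  · rw [abs_of_nonpos h]
    have hneg : ∀ s ∈ Ioo (-T) T, -s ∈ Ioo (-T) T := fun s hs =>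
      ⟨by linarith [hs.2], by linarith [hs.1]⟩
    have := forward (fun s => b (-s)) (fun s => -b' (-s))
      (fun s hs => by
        have := (hb _ (hneg s hs)).scomp s (hasDerivAt_neg s)
        simpa [Function.comp_def] using this)
      (fun s hs => by simpa using hD _ (hneg s hs)) (-t) (hneg t ht) (by linarith)
    simpa using this

/-- Global existence for the Schrödinger equation, in weighted coefficients seen from the linear
flow. -/
theorem exists_global_solution {σ : ℝ} (hσ : |σ| ≤ 1) (b₀ : SummableCoeffs) :
    ∃ b : ℝ → SummableCoeffs, b 0 = b₀ ∧
      ∀ t, HasDerivAt b (cubicForm (weightedKernel σ t) (b t)) t := by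
  obtain ⟨L, hL, hbound⟩ := exists_tsum_sq_le_of_solution hσ b₀
  refine exists_global_solution_of_apriori_bound
    (f := fun t b => cubicForm (weightedKernel σ t) b)
    (fun a => continuous_cubicForm (norm_weightedKernel_le_const hσ)
      (continuous_weightedKernel σ) a)
    (fun R => (3 * 729 * R ^ 2).toNNReal) (fun R t => ?_) (fun t => cubicForm_zero _)
    (B := fun T => ‖b₀‖ * Real.exp (3 * 243 * L * |max T 0|)) (fun S T hST => ?_)
    (fun T hT b hb0 hb t ht => ?_)
  · refine LipschitzOnWith.of_dist_le_mul fun x hx y hy => ?_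
    rw [dist_eq_norm, dist_eq_norm, Real.coe_toNNReal _ (by positivity)]
    exact norm_cubicForm_sub_le (norm_weightedKernel_le_const hσ t) (by simpa using hx)
      (by simpa using hy)
  · have : |max S 0| ≤ |max T 0| := by
      rw [abs_of_nonneg (le_max_right _ _), abs_of_nonneg (le_max_right _ _)]
      exact max_le_max hST le_rfl
    simp only
    gcongr
  · have h := norm_le_mul_exp_of_norm_deriv_le (D := 3 * 243 * L) hb (fun s hs => ?_) ht
    · rw [hb0] at h
      refine h.trans ?_
      have : |t| ≤ |max T 0| := by
        rw [abs_of_nonneg (le_max_right T 0)]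
        exact (abs_le.2 ⟨ht.1.le, ht.2.le⟩).trans (le_max_left _ _)
      gcongr
    · have h1 := norm_cubicForm_le_of_kernel_le (norm_weightedKernel_le_const hσ s)
        (β := fun n => (coeffWeight n)⁻¹) (fun n => (inv_pos.2 (coeffWeight_pos n)).le)
        (fun n => inv_le_one_of_one_le₀ (one_le_coeffWeight n)) (norm_weightedKernel_le hσ s) (b s)
      have h2 := hbound T hT b hb0 hb s hs
      have e : ∑' n, (coeffWeight n)⁻¹ * ‖b s n‖ = ∑' n, ‖weightedSymbol 0 n * b s n‖ := by
        refine tsum_congr fun n => ?_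
        rw [norm_mul, weightedSymbol_zero_apply, Complex.norm_real,
          Real.norm_of_nonneg (inv_pos.2 (coeffWeight_pos n)).le]
      rw [e] at h1
      refine h1.trans ?_
      gcongr

end GlobalSolutions

/-! ### Classical solutions -/

noncomputable section ClassicalSolutions

open scoped ComplexConjugate

/-- The multiplier `2πin / (1 + n²)³` of the space derivative. -/
def gradientSymbol : Multiplier :=
  Multiplier.ofBounded (fun n => 2 * Real.pi * Complex.I * n * weightedSymbol 0 n) 41 fun n => by
    have h1 := coeffWeight_pos n
    have h2 : |2 * Real.pi * n| ≤ 1 + laplaceEigenvalue n := by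
      rw [laplaceEigenvalue, ← sq_abs (2 * Real.pi * n)]
      nlinarith [sq_nonneg (|2 * Real.pi * n| - 1)]
    have h3 : 1 + (n : ℝ) ^ 2 ≤ coeffWeight n :=
      le_self_pow₀ (by nlinarith [sq_nonneg (n : ℝ)]) (by norm_num)
    have e : (2 * Real.pi * Complex.I * n * weightedSymbol 0 n : ℂ)
        = Complex.I * ((2 * Real.pi * n * (coeffWeight n)⁻¹ : ℝ) : ℂ) := by
      rw [weightedSymbol_zero_apply]; push_cast; ring
    rw [e, norm_mul, Complex.norm_I, one_mul, Complex.norm_real, norm_mul, norm_inv,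
      Real.norm_of_nonneg h1.le, Real.norm_eq_abs, ← div_eq_mul_inv, div_le_iff₀ h1]
    have := laplaceEigenvalue_le n
    nlinarith [sq_nonneg (n : ℝ)]

theorem gradientSymbol_apply (n : ℤ) :
    gradientSymbol n = 2 * Real.pi * Complex.I * n * weightedSymbol 0 n := rfl

theorem planeWave_zero_mul_apply (z : ℂ) (f : C(UnitAddCircle, ℂ)) (x : UnitAddCircle) :
    (planeWave 0 z * f) x = z * f x := by
  rw [ContinuousMap.mul_apply, planeWave_apply, fourier_zero, mul_one]

theorem hasDerivAt_solutionAt_space (t : ℝ) (b : SummableCoeffs) (x : ℝ) :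
    HasDerivAt (fun y : ℝ => solutionAt t b (y : UnitAddCircle))
      (fourierSynthesis (evolve gradientSymbol t) b (x : UnitAddCircle)) x :=
  hasDerivAt_fourierSynthesis _ _ b (fun n => by
    rw [evolve_apply, evolve_apply, gradientSymbol_apply, mul_assoc]) x

theorem hasDerivAt_gradient_space (t : ℝ) (b : SummableCoeffs) (x : ℝ) :
    HasDerivAt (fun y : ℝ => fourierSynthesis (evolve gradientSymbol t) b (y : UnitAddCircle))
      (Complex.I * dispersionAt t b (x : UnitAddCircle)) x := by
  set ν : Multiplier := Multiplier.ofBounded (fun n => Complex.I * evolve (weightedSymbol 1) t n)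
    ‖evolve (weightedSymbol 1) t‖ (fun n => by
      rw [norm_mul, Complex.norm_I, one_mul]
      exact BoundedContinuousFunction.norm_coe_le_norm _ n) with hν
  have e : fourierSynthesis ν b (x : UnitAddCircle)
      = Complex.I * dispersionAt t b (x : UnitAddCircle) := by
    refine (hasSum_fourierSynthesis_apply ν b x).unique ?_
    refine ((hasSum_fourierSynthesis_apply (evolve (weightedSymbol 1) t) b
      (x : UnitAddCircle)).mul_left Complex.I).congr_terms fun n => ?_
    rw [hν, Multiplier.ofBounded_apply]
    ring
  rw [← e]
  refine hasDerivAt_fourierSynthesis _ _ b (fun n => ?_) x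
  have h1 := weightedSymbol_succ 0 n
  have h1 : weightedSymbol 1 n = Complex.I * laplaceEigenvalue n * weightedSymbol 0 n := h1
  rw [hν, Multiplier.ofBounded_apply, evolve_apply, evolve_apply, gradientSymbol_apply, h1,
    laplaceEigenvalue]
  push_cast
  ring

theorem iteratedDeriv_two_solutionAt (t : ℝ) (b : SummableCoeffs) :
    iteratedDeriv 2 (fun y : ℝ => solutionAt t b (y : UnitAddCircle))
      = fun x : ℝ => Complex.I * dispersionAt t b (x : UnitAddCircle) := by
  rw [iteratedDeriv_succ, iteratedDeriv_one,
    funext fun x => (hasDerivAt_solutionAt_space t b x).deriv]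
  exact funext fun x => (hasDerivAt_gradient_space t b x).deriv

theorem contDiff_two_solutionAt (t : ℝ) (b : SummableCoeffs) :
    ContDiff ℝ 2 fun y : ℝ => solutionAt t b (y : UnitAddCircle) := by
  rw [show (2 : WithTop ℕ∞) = 1 + 1 from rfl, contDiff_succ_iff_deriv]
  refine ⟨fun x => (hasDerivAt_solutionAt_space t b x).differentiableAt, by simp, ?_⟩
  rw [funext fun x => (hasDerivAt_solutionAt_space t b x).deriv, contDiff_one_iff_deriv]
  refine ⟨fun x => (hasDerivAt_gradient_space t b x).differentiableAt, ?_⟩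
  rw [funext fun x => (hasDerivAt_gradient_space t b x).deriv]
  exact continuous_const.mul ((dispersionAt t b).continuous.comp (AddCircle.continuous_mk' 1))

theorem continuous_eval_of_continuous {X : Type*} [TopologicalSpace X]
    {f : X → C(UnitAddCircle, ℂ)} (hf : Continuous f) {g : X → UnitAddCircle} (hg : Continuous g) :
    Continuous fun p => f p (g p) := by
  fun_prop

/-- A solution in weighted coefficients synthesizes to a classical solution. -/
theorem isClassicalNLSSolution_solutionAt {σ : ℝ} (hσ : |σ| ≤ 1) {b : ℝ → SummableCoeffs}
    (hb : ∀ t, HasDerivAt b (cubicForm (weightedKernel σ t) (b t)) t) :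
    IsClassicalNLSSolution cubic σ fun t x => solutionAt t (b t) x := by
  have hU := fun t => hasDerivAt_solutionAt hσ (hb t)
  have hUx : ∀ (t : ℝ) (x : UnitAddCircle), HasDerivAt (fun t => solutionAt t (b t) x)
      ((dispersionAt t (b t) + nonlinearityAt σ t (b t)) x) t := fun t x =>
    (ContinuousMap.evalCLM ℝ x : C(UnitAddCircle, ℂ) →L[ℝ] ℂ).hasFDerivAt.comp_hasDerivAt t (hU t)
  have hUc : Continuous fun t => solutionAt t (b t) :=
    continuous_iff_continuousAt.2 fun t => (hU t).continuousAt
  have hWc : Continuous fun t => dispersionAt t (b t) :=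
    continuous_iff_continuousAt.2 fun t => (hasDerivAt_dispersionAt (hb t)).continuousAt
  have hNc : Continuous fun t => nonlinearityAt σ t (b t) :=
    continuous_const.mul (hUc.mul (hUc.star.mul hUc))
  refine ⟨?_, fun x t => (hUx t x).differentiableAt, ?_, fun t => contDiff_two_solutionAt t (b t),
    ?_, fun t x => ?_⟩
  · exact continuous_eval_of_continuous (hUc.comp continuous_fst) continuous_snd
  · simp only [(hUx _ _).deriv]
    exact continuous_eval_of_continuous ((hWc.add hNc).comp continuous_fst) continuous_snd
  · simp only [iteratedDeriv_two_solutionAt]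
    exact continuous_const.mul (continuous_eval_of_continuous (hWc.comp continuous_fst)
      ((AddCircle.continuous_mk' 1).comp continuous_snd))
  · rw [(hUx t x).deriv, iteratedDeriv_two_solutionAt, ContinuousMap.add_apply, nonlinearityAt,
      planeWave_zero_mul_apply, cubic]
    simp only [ContinuousMap.mul_apply, ContinuousMap.star_apply, Complex.star_def]
    rw [Complex.conj_mul', mul_add, ← mul_assoc, ← mul_assoc Complex.I Complex.I,
      Complex.I_mul_I]
    push_cast
    ring

/-- The gauge transformation: as the mass is conserved, a phase rotating at constant speed turns
solutions of the cubic equation into solutions of the Wick ordered one. -/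
theorem IsClassicalNLSSolution.wick {σ m : ℝ} {u : ℝ → UnitAddCircle → ℂ}
    (hu : IsClassicalNLSSolution cubic σ u)
    (hm : ∀ t, ∫ x, ‖u t x‖ ^ 2 ∂AddCircle.haarAddCircle = m) :
    IsClassicalNLSSolution wickCubic σ
      fun t x => Complex.exp ((-2 * σ * m * t : ℝ) * Complex.I) * u t x := by
  set g : ℝ → ℂ := fun t => Complex.exp ((-2 * σ * m * t : ℝ) * Complex.I) with hg
  have hgd : ∀ t, HasDerivAt g (g t * ((-2 * σ * m : ℝ) * Complex.I)) t := by
    intro t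
    have h1 : HasDerivAt (fun t : ℝ => ((-2 * σ * m * t : ℝ) : ℂ)) ((-2 * σ * m : ℝ) : ℂ) t := by
      have := ((hasDerivAt_id t).const_mul (-2 * σ * m)).ofReal_comp
      simpa using this
    exact (h1.mul_const Complex.I).cexp
  have hgc : Continuous g := continuous_iff_continuousAt.2 fun t => (hgd t).continuousAt
  have hgn : ∀ t, ‖g t‖ = 1 := fun t => Complex.norm_exp_ofReal_mul_I _
  change IsClassicalNLSSolution wickCubic σ fun t x => g t * u t x
  clear_value g
  have hd : ∀ t x, HasDerivAt (fun t => g t * u t x)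
      (g t * ((-2 * σ * m : ℝ) * Complex.I) * u t x + g t * deriv (fun t => u t x) t) t :=
    fun t x => (hgd t).mul (hu.differentiable_time x t).hasDerivAt
  have h2 : ∀ t x, iteratedDeriv 2 (fun y : ℝ => g t * u t (y : UnitAddCircle)) x
      = g t * iteratedDeriv 2 (fun y : ℝ => u t (y : UnitAddCircle)) x := fun t x =>
    iteratedDeriv_const_mul_field (g t) (fun y : ℝ => u t (y : UnitAddCircle))
  refine ⟨(hgc.comp continuous_fst).mul hu.continuous, fun x t => (hd t x).differentiableAt, ?_,
    fun t => contDiff_const.mul (hu.contDiff_space t), ?_, fun t x => ?_⟩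
  · simp only [(hd _ _).deriv]
    exact (((hgc.comp continuous_fst).mul continuous_const).mul hu.continuous).add
      ((hgc.comp continuous_fst).mul hu.continuous_deriv_time)
  · simp only [h2]
    exact (hgc.comp continuous_fst).mul hu.continuous_deriv_space
  · have he := hu.equation t x
    have hav : ⨍ y, ‖g t * u t y‖ ^ 2 ∂AddCircle.haarAddCircle = m := by
      rw [MeasureTheory.average_eq_integral, ← hm t]
      simp only [norm_mul, hgn, one_mul]
    rw [(hd t x).deriv, h2, wickCubic, hav, norm_mul, hgn, one_mul]
    rw [cubic] at he
    push_cast at he ⊢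
    linear_combination (g t) * he + (-2 * σ * m) * g t * u t x * Complex.I_sq

theorem sobolevNorm_const_mul {z : ℂ} (hz : ‖z‖ = 1) (s : ℝ) (f : UnitAddCircle → ℂ) :
    sobolevNorm s (fun x => z * f x) = sobolevNorm s f := by
  unfold sobolevNorm
  congr 2
  funext n
  rw [fourierCoeff.const_mul, norm_mul, hz, one_mul]

end ClassicalSolutions

/-! ### Growth of low frequencies -/

noncomputable section Inflation

open Set

/-- Division of the coefficients by the weight, which gives the Fourier coefficients of the solution
seen from the linear flow. -/
def unweight : SummableCoeffs →L[ℝ] SummableCoeffs :=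
  LinearMap.mkContinuous
    { toFun := fun b => ⟨fun n => weightedSymbol 0 n * b n, memℓp_gen <| by
        simpa only [ENNReal.toReal_one, Real.rpow_one, norm_planeWave] using
          SummableCoeffs.summable_norm_planeWave (weightedSymbol 0) b⟩
      map_add' := fun a b => lp.ext <| funext fun n => mul_add _ (a n) (b n)
      map_smul' := fun r b => lp.ext <| funext fun n => mul_smul_comm r _ (b n) }
    ‖weightedSymbol 0‖ fun b => by
      rw [SummableCoeffs.norm_eq_tsum, b.norm_eq_tsum, ← tsum_mul_left]
      refine Summable.tsum_le_tsum (fun n => ?_) ?_ (b.summable_norm.mul_left _)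
      · refine (norm_mul_le _ _).trans ?_
        gcongr
        exact BoundedContinuousFunction.norm_coe_le_norm _ n
      · have h := SummableCoeffs.summable_norm_planeWave (weightedSymbol 0) b
        simp only [norm_planeWave] at h
        exact h

theorem unweight_apply (b : SummableCoeffs) (n : ℤ) :
    unweight b n = weightedSymbol 0 n * b n := rfl

/-- Division by the weight takes solutions of the weighted equation to solutions of the unweighted
one. -/
theorem unweight_cubicForm {σ : ℝ} (hσ : |σ| ≤ 1) (t : ℝ) (b : SummableCoeffs) :
    unweight (cubicForm (weightedKernel σ t) b)
      = cubicForm (interactionKernel σ t) (unweight b) := by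
  refine lp.ext (funext fun n => ?_)
  have h1 := (hasSum_cubicForm_apply (norm_weightedKernel_le_const hσ t) b n).mul_left
    (weightedSymbol 0 n)
  have h2 := hasSum_cubicForm_apply (fun p => (norm_interactionKernel σ t p).le) (unweight b) n
  refine (h1.congr_terms fun q => ?_).unique h2
  have hn : (coeffWeight n : ℂ) ≠ 0 := Complex.ofReal_ne_zero.2 (coeffWeight_pos n).ne'
  simp only [unweight_apply, weightedKernel, weightedSymbol_zero_apply, map_mul,
    Complex.conj_ofReal]
  rw [show n + q.1 - q.2 - q.1 + q.2 = n by ring]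
  push_cast
  linear_combination (interactionKernel σ t (n + q.1 - q.2, q.1, q.2)
    * ((coeffWeight (n + q.1 - q.2) : ℂ)⁻¹ * ((coeffWeight q.1 : ℂ)⁻¹ * (coeffWeight q.2 : ℂ)⁻¹))
    * (b (n + q.1 - q.2) * (starRingEnd ℂ (b q.1) * b q.2))) * inv_mul_cancel₀ hn

theorem norm_fourierCoeff_solutionAt (t : ℝ) (b : SummableCoeffs) (n : ℤ) :
    ‖fourierCoeff (solutionAt t b) n‖ = ‖unweight b n‖ := by
  rw [solutionAt, fourierCoeff_fourierSynthesis, norm_evolve_mul, unweight_apply]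

/-- The coefficients of a trigonometric polynomial with frequencies in `F`. -/
def trigCoeffs (F : Finset ℤ) (c : ℤ → ℂ) : SummableCoeffs := ∑ n ∈ F, lp.single 1 n (c n)

theorem trigCoeffs_apply (F : Finset ℤ) (c : ℤ → ℂ) (n : ℤ) :
    trigCoeffs F c n = if n ∈ F then c n else 0 := by
  rw [trigCoeffs, lp.coeFn_sum, Finset.sum_apply]
  simp only [lp.single_apply, Pi.single_apply]
  simp

theorem unweight_trigCoeffs (F : Finset ℤ) (c : ℤ → ℂ) :
    unweight (trigCoeffs F fun n => coeffWeight n * c n) = trigCoeffs F c := by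
  refine lp.ext (funext fun n => ?_)
  rw [unweight_apply, trigCoeffs_apply, trigCoeffs_apply, weightedSymbol_zero_apply]
  split_ifs
  · have hn : (coeffWeight n : ℂ) ≠ 0 := Complex.ofReal_ne_zero.2 (coeffWeight_pos n).ne'
    push_cast
    rw [inv_mul_cancel_left₀ hn]
  · rw [mul_zero]

theorem norm_trigCoeffs_le (F : Finset ℤ) (c : ℤ → ℂ) : ‖trigCoeffs F c‖ ≤ ∑ n ∈ F, ‖c n‖ := by
  refine (norm_sum_le _ _).trans_eq (Finset.sum_congr rfl fun n _ => ?_)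
  rw [lp.norm_single (by norm_num)]

/-- Summable coefficients as a bounded sequence, which gives access to their supremum norm. -/
def toMultiplier : SummableCoeffs →L[ℝ] Multiplier :=
  LinearMap.mkContinuous
    { toFun := fun a => Multiplier.ofBounded (fun n => a n) ‖a‖ a.norm_apply_le
      map_add' := fun _ _ => rfl
      map_smul' := fun _ _ => rfl }
    1 fun a => by
      rw [one_mul]
      exact (BoundedContinuousFunction.norm_le (norm_nonneg _)).2 a.norm_apply_le

theorem toMultiplier_apply (a : SummableCoeffs) (n : ℤ) : toMultiplier a n = a n := rfl

/-- A curve whose speed is small while it stays in a ball of radius `2A` does not leave this ball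
within the time `t₀`. -/
theorem norm_le_two_mul_of_norm_deriv_lt {E : Type*} [NormedAddCommGroup E] [NormedSpace ℝ E]
    {y y' : ℝ → E} (hy : ∀ t, HasDerivAt y (y' t) t) {A t₀ : ℝ} (ht₀ : 0 < t₀) (hA : 0 ≤ A)
    (h0 : ‖y 0‖ ≤ A) (hs : ∀ t ∈ Icc 0 t₀, ‖y t‖ ≤ 2 * A → t₀ * ‖y' t‖ < A) :
    ∀ t ∈ Icc 0 t₀, ‖y t‖ ≤ 2 * A := by
  intro t ht
  have hle : ∀ t ∈ Icc 0 t₀, A + A / t₀ * t ≤ 2 * A := fun t ht => by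
    have : A / t₀ * t ≤ A / t₀ * t₀ := mul_le_mul_of_nonneg_left ht.2 (by positivity)
    rw [div_mul_cancel₀ _ ht₀.ne'] at this
    linarith
  refine (image_norm_le_of_norm_deriv_right_lt_deriv_boundary (f' := y')
    (B := fun t => A + A / t₀ * t) (B' := fun _ => A / t₀)
    (fun s _ => (hy s).continuousAt.continuousWithinAt) (fun s _ => (hy s).hasDerivWithinAt)
    (by simpa using h0) (fun s => ?_) (fun s hs' hsB => ?_) ht).trans (hle t ht)
  · simpa using ((hasDerivAt_id s).const_mul (A / t₀)).const_add A
  · have hs'' := Ico_subset_Icc_self hs'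
    rw [lt_div_iff₀ ht₀, mul_comm]
    exact hs s hs'' (hsB ▸ hle s hs'')

/-- The box of frequencies `[N, 4N]`, which the cubic interaction moves to the frequencies
in `[0, N)`. -/
def highBox (N : ℕ) : Finset ℤ := Finset.Icc (N : ℤ) (4 * N)

theorem card_highBox_le {N : ℕ} (hN : 1 ≤ N) : ((highBox N).card : ℝ) ≤ 4 * N := by
  have h : (highBox N).card ≤ 4 * N := by
    rw [highBox, Int.card_Icc]
    omega
  exact_mod_cast h

theorem norm_trigCoeffs_highBox_le {N : ℕ} (hN : 1 ≤ N) {R : ℝ} (hR : 0 ≤ R) :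
    ‖trigCoeffs (highBox N) fun _ => (R : ℂ)‖ ≤ 4 * N * R := by
  refine (norm_trigCoeffs_le _ _).trans ?_
  rw [Finset.sum_const, nsmul_eq_mul, Complex.norm_real, Real.norm_of_nonneg hR]
  exact mul_le_mul_of_nonneg_right (card_highBox_le hN) hR

/-- The first interaction of the high frequencies in the box is coherent for times `t ≪ N⁻²`: there
are `N²` ways to obtain a frequency in `[0, N)`, all with nearly the same phase. -/
theorem le_re_cubicForm_highBox {N : ℕ} (hN : 1 ≤ N) {R σ t : ℝ} (hR : 0 ≤ R) (hσ : σ ^ 2 = 1)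
    (ht : 0 ≤ t) (htN : (N : ℝ) ^ 2 * t ≤ 1 / 10 ^ 6) {n : ℤ} (hn0 : 0 ≤ n) (hnN : n < N) :
    R ^ 3 * N ^ 2 / 2 ≤
      (-(Complex.I * σ) * cubicForm (interactionKernel σ t)
        (trigCoeffs (highBox N) fun _ => (R : ℂ)) n).re := by
  set φ := trigCoeffs (highBox N) fun _ => (R : ℂ) with hφ
  have h := ((hasSum_cubicForm_apply (fun p => (norm_interactionKernel σ t p).le) φ n).mul_left
    (-(Complex.I * σ))).mapL Complex.reCLM
  have hterm : ∀ p : ℤ × ℤ × ℤ, p.1 - p.2.1 + p.2.2 = n →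
      (-(Complex.I * σ) * (interactionKernel σ t p
        * (φ p.1 * (starRingEnd ℂ (φ p.2.1) * φ p.2.2)))).re
      = if p.1 ∈ highBox N ∧ p.2.1 ∈ highBox N ∧ p.2.2 ∈ highBox N then
        R ^ 3 * Real.cos ((laplaceEigenvalue p.1 - laplaceEigenvalue p.2.1
          + laplaceEigenvalue p.2.2 - laplaceEigenvalue n) * t) else 0 := by
    intro p hp
    split_ifs with hb
    · rw [hφ, trigCoeffs_apply, trigCoeffs_apply, trigCoeffs_apply, if_pos hb.1, if_pos hb.2.1,
        if_pos hb.2.2, interactionKernel, hp, Complex.conj_ofReal]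
      set θ : ℝ := (laplaceEigenvalue p.1 - laplaceEigenvalue p.2.1
          + laplaceEigenvalue p.2.2 - laplaceEigenvalue n) * t
      have hσ' : (σ : ℂ) ^ 2 = 1 := by exact_mod_cast hσ
      have e : -(Complex.I * σ) * (Complex.I * σ * Complex.exp (θ * Complex.I)
          * ((R : ℂ) * (R * R))) = ((R ^ 3 : ℝ) : ℂ) * Complex.exp (θ * Complex.I) := by
        push_cast
        linear_combination (-(σ : ℂ) ^ 2 * Complex.exp (θ * Complex.I) * R ^ 3) * Complex.I_sq
          + Complex.exp (θ * Complex.I) * R ^ 3 * hσ'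
      rw [e, Complex.re_ofReal_mul, Complex.exp_ofReal_mul_I_re]
    · have : φ p.1 * (starRingEnd ℂ (φ p.2.1) * φ p.2.2) = 0 := by
        by_contra hne
        refine hb ⟨?_, ?_, ?_⟩ <;> by_contra hmem <;> refine hne ?_ <;>
          simp only [hφ, trigCoeffs_apply, if_neg hmem, zero_mul, mul_zero, map_zero]
      rw [this, mul_zero, mul_zero, Complex.zero_re]
  have hcos : ∀ p : ℤ × ℤ × ℤ, p.1 ∈ highBox N ∧ p.2.1 ∈ highBox N ∧ p.2.2 ∈ highBox N →
      1 / 2 ≤ Real.cos ((laplaceEigenvalue p.1 - laplaceEigenvalue p.2.1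
          + laplaceEigenvalue p.2.2 - laplaceEigenvalue n) * t) := by
    intro p hp
    have hNr : (1 : ℝ) ≤ N := by exact_mod_cast hN
    have hl : ∀ m : ℤ, 0 ≤ m → m ≤ 4 * N →
        0 ≤ laplaceEigenvalue m * t ∧ laplaceEigenvalue m * t ≤ 1 / 1000 := by
      intro m hm0 hm
      have h1 : (m : ℝ) ≤ 4 * N := by exact_mod_cast hm
      have h0 : (0 : ℝ) ≤ m := by exact_mod_cast hm0
      refine ⟨mul_nonneg (laplaceEigenvalue_nonneg m) ht, ?_⟩
      have h2 : laplaceEigenvalue m ≤ 680 * (N : ℝ) ^ 2 :=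
        (laplaceEigenvalue_le m).trans (by nlinarith)
      nlinarith [mul_le_mul_of_nonneg_right h2 ht]
    simp only [highBox, Finset.mem_Icc] at hp
    have l1 := hl p.1 (by omega) (by omega)
    have l2 := hl p.2.1 (by omega) (by omega)
    have l3 := hl p.2.2 (by omega) (by omega)
    have l4 := hl n hn0 (by omega)
    refine le_trans ?_ Real.one_sub_sq_div_two_le_cos
    have e : |(laplaceEigenvalue p.1 - laplaceEigenvalue p.2.1
          + laplaceEigenvalue p.2.2 - laplaceEigenvalue n) * t| ≤ 1 := by
      rw [abs_le]
      constructor <;> nlinarith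
    have := (sq_le_one_iff_abs_le_one _).2 e
    linarith
  have hnonneg : ∀ q : ℤ × ℤ, 0 ≤ Complex.reCLM (-(Complex.I * σ) *
      (interactionKernel σ t (n + q.1 - q.2, q.1, q.2)
        * (φ (n + q.1 - q.2) * (starRingEnd ℂ (φ q.1) * φ q.2)))) := by
    intro q
    refine (hterm (n + q.1 - q.2, q.1, q.2) (by ring)).symm.subst
      (motive := fun x : ℝ => 0 ≤ x) ?_
    split_ifs with hb
    · exact mul_nonneg (by positivity) (by linarith [hcos _ hb])
    · exact le_rfl
  -- Frequencies `i`, `k` in `[N, 2N)` and `j = i + k - n` contribute.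
  set ι : ℤ × ℤ → ℤ × ℤ := fun q => (q.1 + q.2 - n, q.2) with hι
  have hinj : Function.Injective ι := by
    rintro ⟨i, k⟩ ⟨i', k'⟩ hq
    simp only [hι, Prod.mk.injEq] at hq ⊢
    omega
  set F := ((Finset.Ico (N : ℤ) (2 * N)) ×ˢ (Finset.Ico (N : ℤ) (2 * N))).image ι with hF
  have hcard : F.card = N * N := by
    rw [hF, Finset.card_image_of_injective _ hinj, Finset.card_product, Int.card_Ico]
    have : (2 * (N : ℤ) - N).toNat = N := by omega
    rw [this]
  have hle := sum_le_hasSum F (fun q _ => hnonneg q) h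
  refine le_trans ?_ hle
  have hFterm : ∀ q ∈ F, R ^ 3 / 2 ≤ Complex.reCLM (-(Complex.I * σ) *
      (interactionKernel σ t (n + q.1 - q.2, q.1, q.2)
        * (φ (n + q.1 - q.2) * (starRingEnd ℂ (φ q.1) * φ q.2)))) := by
    intro q hq
    obtain ⟨⟨i, k⟩, hik, rfl⟩ := Finset.mem_image.1 hq
    rw [Finset.mem_product, Finset.mem_Ico, Finset.mem_Ico] at hik
    simp only at hik
    have hb : n + (ι (i, k)).1 - (ι (i, k)).2 ∈ highBox N ∧ (ι (i, k)).1 ∈ highBox N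
        ∧ (ι (i, k)).2 ∈ highBox N := by
      simp only [hι, highBox, Finset.mem_Icc]
      omega
    refine (hterm (n + (ι (i, k)).1 - (ι (i, k)).2, (ι (i, k)).1, (ι (i, k)).2) (by ring)).symm.subst
      (motive := fun x : ℝ => R ^ 3 / 2 ≤ x) ?_
    rw [if_pos hb, div_eq_mul_one_div]
    exact mul_le_mul_of_nonneg_left (hcos _ hb) (by positivity)
  have := Finset.card_nsmul_le_sum F _ _ hFterm
  rw [hcard, nsmul_eq_mul] at this
  refine le_trans (le_of_eq ?_) this
  push_cast
  ring

/-- Starting from the box of high frequencies, the low frequencies grow linearly in time with the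
rate of the first interaction, as long as `t ≪ N⁻²` and `t ≪ (RN)⁻²`. -/
theorem le_norm_apply_of_solution {N : ℕ} (hN : 1 ≤ N) {R σ t₀ : ℝ} (hR : 0 < R)
    (hσ : σ ^ 2 = 1) (ht₀ : 0 < t₀) (htN : (N : ℝ) ^ 2 * t₀ ≤ 1 / 10 ^ 6)
    (htR : R ^ 2 * (N : ℝ) ^ 2 * t₀ ≤ 1 / 10 ^ 6) {y : ℝ → SummableCoeffs}
    (hy : ∀ t, HasDerivAt y (cubicForm (interactionKernel σ t) (y t)) t)
    (hy0 : y 0 = trigCoeffs (highBox N) fun _ => (R : ℂ)) {n : ℤ} (hn0 : 0 ≤ n) (hnN : n < N) :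
    R ^ 3 * N ^ 2 / 4 * t₀ ≤ ‖y t₀ n‖ := by
  have hNr : (1 : ℝ) ≤ N := by exact_mod_cast hN
  have hσ1 : |σ| = 1 := by
    rcases mul_self_eq_one_iff.1 ((sq σ).symm.trans hσ) with h | h <;> simp [h]
  have hK : ∀ t p, ‖interactionKernel σ t p‖ ≤ 1 := fun t p =>
    (norm_interactionKernel σ t p).trans_le hσ1.le
  set M : ℝ := 4 * N * R with hM
  have hM0 : 0 < M := by positivity
  have hMt : M ^ 2 * t₀ ≤ 16 / 10 ^ 6 := by
    have : M ^ 2 * t₀ = 16 * (R ^ 2 * (N : ℝ) ^ 2 * t₀) := by rw [hM]; ring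
    rw [this]; linarith
  have hφ : ‖y 0‖ ≤ M := hy0 ▸ norm_trigCoeffs_highBox_le hN hR.le
  -- The sum of the coefficients at most doubles.
  have h1 : ∀ t ∈ Icc 0 t₀, ‖y t‖ ≤ 2 * M := by
    refine norm_le_two_mul_of_norm_deriv_lt hy ht₀ hM0.le hφ fun t _ hyt => ?_
    have hc : ‖cubicForm (interactionKernel σ t) (y t)‖ ≤ 8 * M ^ 3 := by
      refine (norm_cubicForm_le (hK t) (y t)).trans ?_
      rw [one_mul]
      refine (pow_le_pow_left₀ (norm_nonneg _) hyt 3).trans_eq ?_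
      ring
    calc t₀ * _ ≤ t₀ * (8 * M ^ 3) := mul_le_mul_of_nonneg_left hc ht₀.le
      _ = 8 * (M ^ 2 * t₀) * M := by ring
      _ ≤ 8 * (16 / 10 ^ 6) * M := by gcongr
      _ < M := by linarith
  -- So does their supremum.
  have hz : ∀ t, HasDerivAt (fun t => toMultiplier (y t))
      (toMultiplier (cubicForm (interactionKernel σ t) (y t))) t := fun t =>
    toMultiplier.hasFDerivAt.comp_hasDerivAt t (hy t)
  have hspeed : ∀ t ∈ Icc 0 t₀, ‖toMultiplier (y t)‖ ≤ 2 * R →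
      ‖toMultiplier (cubicForm (interactionKernel σ t) (y t))‖ ≤ 24 * M ^ 2 * R := by
    intro t ht hzt
    refine (BoundedContinuousFunction.norm_le (by positivity)).2 fun m => ?_
    have := norm_cubicForm_apply_sub_le (hK t) (h1 t ht)
      (b := 0) (by rw [norm_zero]; positivity) (S := 2 * R) (fun k => by
        have h := ((toMultiplier (y t)).norm_coe_le_norm k).trans hzt
        rw [toMultiplier_apply] at h
        simpa using h) m
    rw [cubicForm_zero] at this
    refine le_trans (le_of_eq ?_) (this.trans_eq ?_)
    · rw [toMultiplier_apply]; simp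
    · ring
  have hzφ : ‖toMultiplier (y 0)‖ ≤ R := by
    refine (BoundedContinuousFunction.norm_le hR.le).2 fun m => ?_
    rw [toMultiplier_apply, hy0, trigCoeffs_apply]
    split_ifs
    · rw [Complex.norm_real, Real.norm_of_nonneg hR.le]
    · rw [norm_zero]; exact hR.le
  have h2 : ∀ t ∈ Icc 0 t₀, ‖toMultiplier (y t)‖ ≤ 2 * R := by
    refine norm_le_two_mul_of_norm_deriv_lt hz ht₀ hR.le hzφ fun t ht hzt => ?_
    calc t₀ * _ ≤ t₀ * (24 * M ^ 2 * R) := mul_le_mul_of_nonneg_left (hspeed t ht hzt) ht₀.le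
      _ = 24 * (M ^ 2 * t₀) * R := by ring
      _ ≤ 24 * (16 / 10 ^ 6) * R := by gcongr
      _ < R := by linarith
  -- Therefore each coefficient moves by `O(M² R t₀)`, a small fraction of `R`.
  have h3 : ∀ t ∈ Icc 0 t₀, ∀ k, ‖y t k - y 0 k‖ ≤ 24 * M ^ 2 * R * t₀ := by
    intro t ht k
    have := norm_image_sub_le_of_norm_deriv_le_segment' (f := fun t => toMultiplier (y t))
      (fun s _ => (hz s).hasDerivWithinAt)
      (fun s hs => hspeed s (Ico_subset_Icc_self hs) (h2 s (Ico_subset_Icc_self hs))) t ht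
    rw [sub_zero] at this
    refine ((toMultiplier (y t) - toMultiplier (y 0)).norm_coe_le_norm k).trans (this.trans ?_)
    exact mul_le_mul_of_nonneg_left ht.2 (by positivity)
  -- The factor `-iσ` turns the first interaction into a positive real number.
  have hd : ∀ t, HasDerivAt (fun t => (-(Complex.I * σ) * y t n).re)
      (-(Complex.I * σ) * cubicForm (interactionKernel σ t) (y t) n).re t := by
    intro t
    have e1 : HasDerivAt (fun t => y t n) (cubicForm (interactionKernel σ t) (y t) n) t :=
      (lp.evalCLM ℝ (fun _ : ℤ => ℂ) 1 n).hasFDerivAt.comp_hasDerivAt t (hy t)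
    exact Complex.reCLM.hasFDerivAt.comp_hasDerivAt t (e1.const_mul (-(Complex.I * σ)))
  have hzσ : ‖(-(Complex.I * σ) : ℂ)‖ = 1 := by
    rw [norm_neg, norm_mul, Complex.norm_I, one_mul, Complex.norm_real, Real.norm_eq_abs, hσ1]
  have hlow : ∀ t ∈ Icc 0 t₀, R ^ 3 * N ^ 2 / 4
      ≤ (-(Complex.I * σ) * cubicForm (interactionKernel σ t) (y t) n).re := by
    intro t ht
    have hmain := le_re_cubicForm_highBox hN hR.le hσ ht.1
      ((mul_le_mul_of_nonneg_left ht.2 (by positivity)).trans htN) hn0 hnN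
    rw [← hy0] at hmain
    have herr := norm_cubicForm_apply_sub_le (hK t) (h1 t ht)
      (hφ.trans (by linarith)) (h3 t ht) n
    have hre := (Complex.abs_re_le_norm (-(Complex.I * σ)
      * (cubicForm (interactionKernel σ t) (y t) n - cubicForm (interactionKernel σ t) (y 0) n)))
    rw [norm_mul, hzσ, one_mul, mul_sub, Complex.sub_re] at hre
    have hb : 3 * 1 * (2 * M) ^ 2 * (24 * M ^ 2 * R * t₀) ≤ R ^ 3 * N ^ 2 / 4 := by
      have e : 3 * 1 * (2 * M) ^ 2 * (24 * M ^ 2 * R * t₀)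
          = 73728 * (R ^ 2 * (N : ℝ) ^ 2 * t₀) * (R ^ 3 * N ^ 2) := by rw [hM]; ring
      rw [e]
      have : 0 ≤ R ^ 3 * (N : ℝ) ^ 2 := by positivity
      nlinarith
    linarith [(abs_le.1 (hre.trans (herr.trans hb))).1]
  have hmvt := (convex_Icc 0 t₀).mul_sub_le_image_sub_of_le_deriv
    (fun t _ => (hd t).continuousAt.continuousWithinAt)
    (fun t _ => (hd t).differentiableAt.differentiableWithinAt)
    (C := R ^ 3 * N ^ 2 / 4)
    (fun t ht => (hd t).deriv.symm ▸ hlow t (interior_subset ht)) 0 ⟨le_rfl, ht₀.le⟩ t₀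
    ⟨ht₀.le, le_rfl⟩ ht₀.le
  have hstart : y 0 n = 0 := by
    rw [hy0, trigCoeffs_apply, if_neg]
    simp only [highBox, Finset.mem_Icc]
    omega
  simp only [hstart, mul_zero, Complex.zero_re, sub_zero] at hmvt
  refine hmvt.trans ((Complex.re_le_norm _).trans_eq ?_)
  rw [norm_mul, hzσ, one_mul]

end Inflation

/-! ### Sobolev norms -/

theorem sobolevNorm_lt {s ε : ℝ} (hε : 0 < ε) {f : UnitAddCircle → ℂ} {F : Finset ℤ}
    (hF : ∀ n ∉ F, fourierCoeff f n = 0)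
    (h : ∑ n ∈ F, (1 + (n : ℝ) ^ 2) ^ s * ‖fourierCoeff f n‖ ^ 2 < ε ^ 2) :
    sobolevNorm s f < ENNReal.ofReal ε := by
  have e : ENNReal.ofReal ε = ENNReal.ofReal (ε ^ 2) ^ (1 / 2 : ℝ) := by
    rw [ENNReal.ofReal_rpow_of_nonneg (by positivity) (by norm_num), ← Real.sqrt_eq_rpow,
      Real.sqrt_sq hε.le]
  rw [e, sobolevNorm, tsum_eq_sum (s := F) (fun n hn => by simp [hF n hn])]
  refine ENNReal.rpow_lt_rpow ?_ (by norm_num)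
  rw [← ENNReal.ofReal_sum_of_nonneg (fun n _ => by positivity)]
  exact (ENNReal.ofReal_lt_ofReal_iff (by positivity)).2 h

theorem lt_sobolevNorm {s A : ℝ} (hA : 0 < A) {f : UnitAddCircle → ℂ} (F : Finset ℤ)
    (h : A ^ 2 < ∑ n ∈ F, (1 + (n : ℝ) ^ 2) ^ s * ‖fourierCoeff f n‖ ^ 2) :
    ENNReal.ofReal A < sobolevNorm s f := by
  have e : ENNReal.ofReal A = ENNReal.ofReal (A ^ 2) ^ (1 / 2 : ℝ) := by
    rw [ENNReal.ofReal_rpow_of_nonneg (by positivity) (by norm_num), ← Real.sqrt_eq_rpow,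
      Real.sqrt_sq hA.le]
  rw [e, sobolevNorm]
  refine ENNReal.rpow_lt_rpow ?_ (by norm_num)
  refine lt_of_lt_of_le ?_ (ENNReal.sum_le_tsum F)
  rw [← ENNReal.ofReal_sum_of_nonneg (fun n _ => by positivity)]
  exact (ENNReal.ofReal_lt_ofReal_iff ((by positivity : 0 < A ^ 2).trans h)).2 h

/-- The factor `N^{-2s-1}` reduces the case `s ≤ -1/2` to the critical weights
`(1 + n²)^{-1/2} ≥ 1 / (n + 1)`. -/
theorem one_div_succ_le_rpow {s : ℝ} (hs : s ≤ -(1 / 2)) {N n : ℕ} (hn : n < N) :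
    1 / ((n : ℝ) + 1) ≤ (N : ℝ) ^ (-2 * s - 1) * (1 + (n : ℝ) ^ 2) ^ s := by
  have hNn : (n : ℝ) + 1 ≤ N := by exact_mod_cast hn
  have hn0 : (0 : ℝ) ≤ n := by positivity
  have hN0 : (0 : ℝ) < N := by linarith
  have hw : (0 : ℝ) < 1 + (n : ℝ) ^ 2 := by positivity
  have h1 : (1 + (n : ℝ) ^ 2) ^ (-s - 1 / 2) ≤ (N : ℝ) ^ (-2 * s - 1) := by
    have e : (N : ℝ) ^ (-2 * s - 1) = ((N : ℝ) ^ 2) ^ (-s - 1 / 2) := by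
      rw [← Real.rpow_natCast, ← Real.rpow_mul hN0.le]
      congr 1
      push_cast
      ring
    rw [e]
    exact Real.rpow_le_rpow hw.le (by nlinarith) (by linarith)
  have h2 : 1 / ((n : ℝ) + 1) ≤ (1 + (n : ℝ) ^ 2) ^ (-(1 / 2) : ℝ) := by
    rw [Real.rpow_neg hw.le, ← Real.sqrt_eq_rpow, one_div]
    refine inv_anti₀ (Real.sqrt_pos.2 hw) ?_
    rw [Real.sqrt_le_left (by positivity)]
    nlinarith
  refine h2.trans ?_
  have e : (1 + (n : ℝ) ^ 2) ^ (-(1 / 2) : ℝ)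
      = (1 + (n : ℝ) ^ 2) ^ (-s - 1 / 2) * (1 + (n : ℝ) ^ 2) ^ s := by
    rw [← Real.rpow_add hw]
    congr 1
    ring
  rw [e]
  gcongr

/-! ### Norm inflation -/

/-- For large `N`, the solution starting from `δ N^{-s-1/2} ∑_{N ≤ n ≤ 4N} e^{2πinx}` is small in
`Hˢ` at time `0` and large in `Hˢ` at the time `t ∼ N^{2s-1}`. -/
theorem exists_solution_norm_inflation {s σ ε : ℝ} (hs : s ≤ -(1 / 2)) (hσ : σ ^ 2 = 1)
    (hε : 0 < ε) :
    ∃ b : ℝ → SummableCoeffs, (∀ t, HasDerivAt b (cubicForm (weightedKernel σ t) (b t)) t) ∧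
      ∃ t : ℝ, 0 < t ∧ t < ε ∧
        sobolevNorm s (solutionAt 0 (b 0)) < ENNReal.ofReal ε ∧
        ENNReal.ofReal ε⁻¹ < sobolevNorm s (solutionAt t (b t)) := by
  have hσ1 : |σ| ≤ 1 := by
    rcases mul_self_eq_one_iff.1 ((sq σ).symm.trans hσ) with h | h <;> simp [h]
  obtain ⟨δ, hδ0, hδ1, hδε⟩ : ∃ δ : ℝ, 0 < δ ∧ δ ≤ 1 ∧ 4 * δ ≤ ε :=
    ⟨min 1 (ε / 4), by positivity, min_le_left _ _, by linarith [min_le_right 1 (ε / 4)]⟩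
  -- The constant in front of the harmonic sum bounding the final norm from below.
  set κ : ℝ := δ ^ 6 / (16 * 10 ^ 12) with hκ
  have hκ0 : 0 < κ := by positivity
  obtain ⟨N, hsum, hNε, hN⟩ :=
    ((Real.tendsto_sum_range_one_div_nat_succ_atTop.eventually_gt_atTop (ε⁻¹ ^ 2 / κ)).and
      ((tendsto_natCast_atTop_atTop.eventually_gt_atTop ε⁻¹).and
        (Filter.eventually_ge_atTop 1))).exists
  have hNr : (1 : ℝ) ≤ N := by exact_mod_cast hN
  have hN0 : (0 : ℝ) < N := by linarith
  set R : ℝ := δ * (N : ℝ) ^ (-s - 1 / 2) with hR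
  have hR0 : 0 < R := by positivity
  have hR2 : R ^ 2 = δ ^ 2 * (N : ℝ) ^ (-2 * s - 1) := by
    rw [hR, mul_pow, ← Real.rpow_natCast ((N : ℝ) ^ (-s - 1 / 2)), ← Real.rpow_mul hN0.le]
    congr 2
    push_cast
    ring
  set t₀ : ℝ := 1 / 10 ^ 6 * (N : ℝ) ^ (2 * s - 1) with ht
  have ht0 : 0 < t₀ := by positivity
  have hN2 : (N : ℝ) ^ 2 * (N : ℝ) ^ (2 * s - 1) = (N : ℝ) ^ (2 * s + 1) := by
    rw [← Real.rpow_natCast, ← Real.rpow_add hN0]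
    congr 1
    push_cast
    ring
  have hNle : (N : ℝ) ^ (2 * s + 1) ≤ 1 :=
    Real.rpow_le_one_of_one_le_of_nonpos hNr (by linarith)
  have htN : (N : ℝ) ^ 2 * t₀ ≤ 1 / 10 ^ 6 := by
    calc (N : ℝ) ^ 2 * t₀ = 1 / 10 ^ 6 * (N : ℝ) ^ (2 * s + 1) := by rw [← hN2, ht]; ring
      _ ≤ 1 / 10 ^ 6 := mul_le_of_le_one_right (by positivity) hNle
  have hRt : R ^ 2 * (N : ℝ) ^ 2 * t₀ = δ ^ 2 / 10 ^ 6 := by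
    have e : (N : ℝ) ^ (-2 * s - 1) * (N : ℝ) ^ (2 * s + 1) = 1 := by
      rw [← Real.rpow_add hN0, show -2 * s - 1 + (2 * s + 1) = 0 by ring, Real.rpow_zero]
    calc R ^ 2 * (N : ℝ) ^ 2 * t₀
        = δ ^ 2 / 10 ^ 6 * ((N : ℝ) ^ (-2 * s - 1) * ((N : ℝ) ^ 2 * (N : ℝ) ^ (2 * s - 1))) := by
          rw [hR2, ht]; ring
      _ = δ ^ 2 / 10 ^ 6 := by rw [hN2, e, mul_one]
  have htε : t₀ < ε := by
    have h1 : ε * N > 1 := by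
      have := mul_lt_mul_of_pos_left hNε hε
      rwa [mul_inv_cancel₀ hε.ne'] at this
    have h2 : (N : ℝ) * t₀ ≤ (N : ℝ) ^ 2 * t₀ :=
      mul_le_mul_of_nonneg_right (by nlinarith) ht0.le
    by_contra! h
    nlinarith [mul_le_mul_of_nonneg_right h hN0.le]
  obtain ⟨b, hb0, hb⟩ :=
    exists_global_solution hσ1 (trigCoeffs (highBox N) fun n => coeffWeight n * (R : ℂ))
  have hy0 : unweight (b 0) = trigCoeffs (highBox N) fun _ => (R : ℂ) := by
    rw [hb0, unweight_trigCoeffs]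
  have hy : ∀ t, HasDerivAt (fun t => unweight (b t))
      (cubicForm (interactionKernel σ t) (unweight (b t))) t := fun t =>
    unweight_cubicForm hσ1 t (b t) ▸ unweight.hasFDerivAt.comp_hasDerivAt t (hb t)
  refine ⟨b, hb, t₀, ht0, htε, ?_, ?_⟩
  · refine sobolevNorm_lt hε (F := highBox N) (fun n hn => ?_) ?_
    · rw [← norm_eq_zero, norm_fourierCoeff_solutionAt, hy0, trigCoeffs_apply, if_neg hn, norm_zero]
    · have hterm : ∀ n ∈ highBox N,
          (1 + (n : ℝ) ^ 2) ^ s * ‖fourierCoeff (solutionAt 0 (b 0)) n‖ ^ 2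
            ≤ (N : ℝ) ^ (2 * s) * R ^ 2 := by
        intro n hn
        rw [norm_fourierCoeff_solutionAt, hy0, trigCoeffs_apply, if_pos hn, Complex.norm_real,
          Real.norm_of_nonneg hR0.le]
        have hnN : (N : ℝ) ≤ n := by exact_mod_cast (Finset.mem_Icc.1 hn).1
        have h1 : (1 + (n : ℝ) ^ 2) ^ s ≤ ((N : ℝ) ^ 2) ^ s :=
          Real.rpow_le_rpow_of_nonpos (by positivity) (by nlinarith) (by linarith)
        rw [← Real.rpow_natCast (N : ℝ), ← Real.rpow_mul hN0.le] at h1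
        exact mul_le_mul_of_nonneg_right (by exact_mod_cast h1) (by positivity)
      have e : (N : ℝ) * ((N : ℝ) ^ (2 * s) * (N : ℝ) ^ (-2 * s - 1)) = 1 := by
        nth_rewrite 1 [← Real.rpow_one (N : ℝ)]
        rw [← Real.rpow_add hN0, ← Real.rpow_add hN0,
          show 1 + (2 * s + (-2 * s - 1)) = 0 by ring, Real.rpow_zero]
      calc ∑ n ∈ highBox N, (1 + (n : ℝ) ^ 2) ^ s * ‖fourierCoeff (solutionAt 0 (b 0)) n‖ ^ 2
          ≤ (highBox N).card • ((N : ℝ) ^ (2 * s) * R ^ 2) := Finset.sum_le_card_nsmul _ _ _ hterm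
        _ = (highBox N).card * ((N : ℝ) ^ (2 * s) * R ^ 2) := nsmul_eq_mul _ _
        _ ≤ 4 * N * ((N : ℝ) ^ (2 * s) * R ^ 2) :=
          mul_le_mul_of_nonneg_right (card_highBox_le hN) (by positivity)
        _ = 4 * δ ^ 2 * (N * ((N : ℝ) ^ (2 * s) * (N : ℝ) ^ (-2 * s - 1))) := by rw [hR2]; ring
        _ = 4 * δ ^ 2 := by rw [e, mul_one]
        _ < ε ^ 2 := by nlinarith
  · refine lt_sobolevNorm (inv_pos.2 hε) ((Finset.range N).map Nat.castEmbedding) ?_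
    rw [Finset.sum_map]
    have hterm : ∀ n ∈ Finset.range N, κ * (1 / ((n : ℝ) + 1))
        ≤ (1 + ((n : ℤ) : ℝ) ^ 2) ^ s * ‖fourierCoeff (solutionAt t₀ (b t₀)) (n : ℤ)‖ ^ 2 := by
      intro n hn
      have hn := Finset.mem_range.1 hn
      have hgrow := le_norm_apply_of_solution hN hR0 hσ ht0 htN
        (hRt.trans_le (by gcongr; exact pow_le_one₀ hδ0.le hδ1)) hy hy0
        (n := n) (by positivity) (by exact_mod_cast hn)
      have e : R ^ 3 * (N : ℝ) ^ 2 / 4 * t₀ = δ ^ 2 / (4 * 10 ^ 6) * R := by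
        calc R ^ 3 * (N : ℝ) ^ 2 / 4 * t₀ = R ^ 2 * (N : ℝ) ^ 2 * t₀ * R / 4 := by ring
          _ = δ ^ 2 / (4 * 10 ^ 6) * R := by rw [hRt]; ring
      rw [e] at hgrow
      rw [norm_fourierCoeff_solutionAt, Int.cast_natCast]
      calc κ * (1 / ((n : ℝ) + 1))
          ≤ κ * ((N : ℝ) ^ (-2 * s - 1) * (1 + (n : ℝ) ^ 2) ^ s) :=
            mul_le_mul_of_nonneg_left (one_div_succ_le_rpow hs hn) hκ0.le
        _ = (1 + (n : ℝ) ^ 2) ^ s * (δ ^ 2 / (4 * 10 ^ 6) * R) ^ 2 := by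
            rw [mul_pow, hR2, hκ]; ring
        _ ≤ _ := by gcongr
    refine lt_of_lt_of_le ?_ (Finset.sum_le_sum hterm)
    rw [← Finset.mul_sum, mul_comm]
    exact (div_lt_iff₀ hκ0).1 hsum

theorem theorem1 (s : ℝ) (hs : s ≤ -(1 / 2)) (σ : ℝ) (hσ : σ = 1 ∨ σ = -1) :
    (∀ ε : ℝ, 0 < ε →
      ∃ u : ℝ → UnitAddCircle → ℂ, IsClassicalNLSSolution cubic σ u ∧
        ∃ t : ℝ, 0 < t ∧ t < ε ∧
          sobolevNorm s (u 0) < ENNReal.ofReal ε ∧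
          ENNReal.ofReal ε⁻¹ < sobolevNorm s (u t)) ∧
    (∀ ε : ℝ, 0 < ε →
      ∃ u : ℝ → UnitAddCircle → ℂ, IsClassicalNLSSolution wickCubic σ u ∧
        ∃ t : ℝ, 0 < t ∧ t < ε ∧
          sobolevNorm s (u 0) < ENNReal.ofReal ε ∧
          ENNReal.ofReal ε⁻¹ < sobolevNorm s (u t)) := by
  have hσ2 : σ ^ 2 = 1 := by rcases hσ with rfl | rfl <;> norm_num
  have hσ1 : |σ| ≤ 1 := by rcases hσ with rfl | rfl <;> norm_num
  refine ⟨fun ε hε => ?_, fun ε hε => ?_⟩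
  · obtain ⟨b, hb, t, ht⟩ := exists_solution_norm_inflation hs hσ2 hε
    exact ⟨_, isClassicalNLSSolution_solutionAt hσ1 hb, t, ht⟩
  · obtain ⟨b, hb, t, ht0, htε, hsmall, hlarge⟩ := exists_solution_norm_inflation hs hσ2 hε
    have hm : ∀ t, ∫ x, ‖solutionAt t (b t) x‖ ^ 2 ∂AddCircle.haarAddCircle = mass 0 (b 0) := by
      intro t
      rw [← mass_eq_integral]
      exact is_const_of_deriv_eq_zero (fun t => (hasDerivAt_mass hσ1 (hb t)).differentiableAt)
        (fun t => (hasDerivAt_mass hσ1 (hb t)).deriv) t 0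
    refine ⟨_, (isClassicalNLSSolution_solutionAt hσ1 hb).wick hm, t, ht0, htε, ?_, ?_⟩
    · rwa [sobolevNorm_const_mul (Complex.norm_exp_ofReal_mul_I _)]
    · rwa [sobolevNorm_const_mul (Complex.norm_exp_ofReal_mul_I _)]
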